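/- Let $n$ be a positive integer and $\lambda=(\lambda_1,\dots,\lambda_k)$ a composition of $n$. The standard cyclic form of $x\in S_n$ is the product of all its disjoint cycles (fixed points included), each written with its smallest entry first, ordered by increasing first entries. The composition type of $x$ is the sequence of the lengths of these cycles, and $A_\lambda\subset S_n$ is the set of permutations of composition type $\lambda$. Let $\Omega(x)\in S_n$ be the permutation whose one-line notation is obtained from the standard cyclic form of $x$ by omitting the parentheses, and put $C_\lambda=\Omega(A_\lambda)$. Order $S_n$ by the Bruhat–Chevalley order, i.e. the reflexive and transitive closure of the relations $x\to y$, where $y=x\cdot(i,j)$ with $i<j$, $x(i)<x(j)$ and $\mathrm{inv}(y)=\mathrm{inv}(x)+1$, and give $C_\lambda$ the restricted order. 1. (Boundedness.) The identity is the minimum of $C_\lambda$. Let $\pi_\lambda=T_1T_2\cdots T_k$, where $T_i$ is the cycle of length $\lambda_i$ whose first entry is $i$ and whose other entries are the $\lambda_i-1$ consecutive integers $n-s_i,\ n-s_i-1,\ \dots,\ n-s_i-(\lambda_i-2)$ in decreasing order, with $s_i=\sum_{j<i}(\lambda_j-1)$ (so $T_i=(i)$ if $\lambda_i=1$). Then $T_1T_2\cdots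 T_k$ is the standard cyclic form of $\pi_\lambda$, $\pi_\lambda\in A_\lambda$, and $\omega_\lambda=\Omega(\pi_\lambda)$ is the maximum of $C_\lambda$. 2. (Gradedness and EL-shellability.) $C_\lambda$ is graded, i.e. all its maximal chains have the same length, and it is EL-shellable: it is a finite graded poset $P$ with minimum and maximum, and it has an EL-labeling. Here an EL-labeling is a map $f$ from the set of covering relations of $P$ to a totally ordered set such that for all $x<y$ in $P$ there is a unique saturated chain $x=x_0<x_1<\dots<x_m=y$ whose label sequence $(f(x_0,x_1),\dots,f(x_{m-1},x_m))$ is weakly increasing, and this label sequence is lexicographically smallest among the label sequences of all saturated chains from $x$ to $y$. 3. (The labeling.) Label each covering relation $x<y$ of $S_n$ by the pair $(i,j)$, $i<j$, with $y=x\cdot(i,j)$, the pairs being ordered lexicographically. Every covering relation of $C_\lambda$ is a covering relation of $S_n$, and the restriction of this labeling to the covering relations of $C_\lambda$ is an EL-labeling of $C_\lambda$. Moreover, for all $x<y$ in $C_\lambda$ there is a unique saturated chain of $S_n$ from $x$ to $y$ with weakly increasing label sequence; its label sequence is lexicographically smallest among all saturated chains of $S_n$ from $x$ to $y$, and all its elements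 lie in $C_\lambda$. -/

import Mathlib

/-! ### The standard cyclic form, the map `Ω`, and the sets `A_λ`, `C_λ`

The ground set `{1, …, n}` is modelled by `Fin n = {0, …, n - 1}`, that is, all entries are
shifted down by one. -/

/-- The cycle of `x` through `a`, written as the list `a, x a, x (x a), …` starting at `a`
(so it is `[a]` if `a` is a fixed point). -/
def cycleList {n : ℕ} (x : Equiv.Perm (Fin n)) (a : Fin n) : List (Fin n) :=
  if x a = a then [a] else x.toList a

/-- The elements of `Fin n` which are the smallest element of their `x`-cycle, in increasing
order. -/
def cycleMins {n : ℕ} (x : Equiv.Perm (Fin n)) : List (Fin n) :=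
  (List.finRange n).filter fun a => ∀ b : Fin n, x.SameCycle a b → a ≤ b

/-- The standard cyclic form of `x`: the list of all cycles (fixed points included), each written
with its smallest element first, ordered by increasing first elements. -/
def standardCyclicForm {n : ℕ} (x : Equiv.Perm (Fin n)) : List (List (Fin n)) :=
  (cycleMins x).map (cycleList x)

/-- The word obtained from the standard cyclic form by omitting the parentheses. -/
def omegaWord {n : ℕ} (x : Equiv.Perm (Fin n)) : List (Fin n) :=
  (standardCyclicForm x).flatten

theorem mem_cycleList {n : ℕ} (x : Equiv.Perm (Fin n)) (a b : Fin n) :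
    b ∈ cycleList x a ↔ x.SameCycle a b := by
  unfold cycleList
  split_ifs with h
  · rw [List.mem_singleton]
    constructor
    · rintro rfl
      exact Equiv.Perm.SameCycle.refl _ _
    · rintro ⟨k, hk⟩
      rw [← hk]
      exact Function.IsFixedPt.perm_zpow h k
  · rw [Equiv.Perm.mem_toList_iff, Equiv.Perm.mem_support]
    exact ⟨fun H => H.1, fun H => ⟨H, h⟩⟩

theorem nodup_cycleList {n : ℕ} (x : Equiv.Perm (Fin n)) (a : Fin n) : (cycleList x a).Nodup := by
  unfold cycleList
  split_ifs with h
  · exact List.nodup_singleton a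
  · exact Equiv.Perm.nodup_toList x a

theorem mem_cycleMins {n : ℕ} (x : Equiv.Perm (Fin n)) (a : Fin n) :
    a ∈ cycleMins x ↔ ∀ b : Fin n, x.SameCycle a b → a ≤ b := by
  simp [cycleMins]

theorem mem_omegaWord {n : ℕ} (x : Equiv.Perm (Fin n)) (b : Fin n) : b ∈ omegaWord x := by
  classical
  have hne : ((Finset.univ : Finset (Fin n)).filter fun a => x.SameCycle a b).Nonempty :=
    ⟨b, Finset.mem_filter.2 ⟨Finset.mem_univ b, Equiv.Perm.SameCycle.refl x b⟩⟩
  obtain ⟨a, ha, hmin⟩ := Finset.exists_min_image _ id hne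
  simp only [Finset.mem_filter, Finset.mem_univ, true_and, id] at ha hmin
  rw [omegaWord, List.mem_flatten]
  refine ⟨cycleList x a, List.mem_map.2 ⟨a, (mem_cycleMins x a).2 fun c hc => ?_, rfl⟩,
    (mem_cycleList x a b).2 ha⟩
  exact hmin c (hc.symm.trans ha)

theorem nodup_omegaWord {n : ℕ} (x : Equiv.Perm (Fin n)) : (omegaWord x).Nodup := by
  rw [omegaWord, List.nodup_flatten]
  constructor
  · intro l hl
    obtain ⟨a, -, rfl⟩ := List.mem_map.1 hl
    exact nodup_cycleList x a
  · rw [standardCyclicForm, List.pairwise_map]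
    have hnd : (cycleMins x).Nodup := (List.nodup_finRange n).filter _
    refine List.Pairwise.imp_of_mem (fun {a b} ha hb hab => ?_) hnd
    intro c hca hcb
    rw [mem_cycleList] at hca hcb
    rw [mem_cycleMins] at ha hb
    have h : x.SameCycle a b := hca.trans hcb.symm
    exact hab (le_antisymm (ha b h) (hb a h.symm))

theorem length_omegaWord {n : ℕ} (x : Equiv.Perm (Fin n)) : (omegaWord x).length = n := by
  have h := Fintype.card_congr
    ((nodup_omegaWord x).getEquivOfForallMemList _ (mem_omegaWord x))
  simpa using h

/-- The map `Ω`: the permutation whose one-line notation is the word of the standard cyclic form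
of `x` with the parentheses omitted, i.e. `Ω x k` is the `k`-th letter of that word. -/
def Omega {n : ℕ} (x : Equiv.Perm (Fin n)) : Equiv.Perm (Fin n) :=
  (finCongr (length_omegaWord x).symm).trans
    ((nodup_omegaWord x).getEquivOfForallMemList _ (mem_omegaWord x))

theorem Omega_apply {n : ℕ} (x : Equiv.Perm (Fin n)) (k : Fin n) :
    Omega x k = (omegaWord x)[(k : ℕ)]'(by rw [length_omegaWord]; exact k.2) :=
  rfl

/-- `A_λ`: the permutations of composition type `λ`, i.e. such that `λ` is the sequence of the
lengths of the cycles in the standard cyclic form. -/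
def compositionClass {n : ℕ} (lam : Composition n) : Set (Equiv.Perm (Fin n)) :=
  {x | (standardCyclicForm x).map List.length = lam.blocks}

/-- `C_λ = Ω(A_λ)`. -/
def omegaClass {n : ℕ} (lam : Composition n) : Set (Equiv.Perm (Fin n)) :=
  Omega '' compositionClass lam

/-- The number `(λ_0 - 1) + ⋯ + (λ_{i-1} - 1)`. -/
def excessUpTo {n : ℕ} (lam : Composition n) (i : Fin lam.length) : ℕ :=
  ∑ j : Fin lam.length, if j < i then lam.blocksFun j - 1 else 0

/-- The cycle `T_i`: first `i`, then the `λ_i - 1` consecutive numbers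
`n - 1 - s, n - 2 - s, …` in decreasing order, where `s = (λ_0 - 1) + ⋯ + (λ_{i-1} - 1)`.
The truncated subtraction never truncates, since `s + (λ_i - 1) ≤ n - 1`. -/
def maxCycle {n : ℕ} (lam : Composition n) (i : Fin lam.length) : List (Fin n) :=
  Fin.castLE lam.length_le i ::
    List.ofFn fun t : Fin (lam.blocksFun i - 1) =>
      (⟨n - 1 - excessUpTo lam i - t, by
        have h1 := i.2
        have h2 := lam.length_le
        omega⟩ : Fin n)

/-- The permutation `π_λ = T_0 T_1 ⋯ T_{k-1}`, a product of cycles. -/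
def maxPerm {n : ℕ} (lam : Composition n) : Equiv.Perm (Fin n) :=
  (List.ofFn fun i : Fin lam.length => (maxCycle lam i).formPerm).prod

/-! ### The Bruhat–Chevalley order -/

/-- The inversion number of `x`. -/
def inversionNumber {n : ℕ} (x : Equiv.Perm (Fin n)) : ℕ :=
  (Finset.univ.filter fun p : Fin n × Fin n => p.1 < p.2 ∧ x p.2 < x p.1).card

/-- The defining covering relations: `y` arises from `x` by exchanging the entries at two
positions `i < j` of the one-line notation with `x i < x j`, and has exactly one inversion more. -/
def BruhatStep {n : ℕ} (x y : Equiv.Perm (Fin n)) : Prop :=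
  inversionNumber y = inversionNumber x + 1 ∧
    ∃ i j : Fin n, i < j ∧ x i < x j ∧ y = x * Equiv.swap i j

theorem eq_or_inversionNumber_lt {n : ℕ} {x y : Equiv.Perm (Fin n)}
    (h : Relation.ReflTransGen BruhatStep x y) :
    x = y ∨ inversionNumber x < inversionNumber y := by
  induction h with
  | refl => exact Or.inl rfl
  | tail _ hbc ih =>
    have h1 := hbc.1
    rcases ih with rfl | ih
    · right; omega
    · right; omega

/-- The Bruhat–Chevalley order on the symmetric group: the (reflexive-)transitive closure of the
covering relations. Subsets of the symmetric group carry the restricted order. -/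
instance bruhatOrder (n : ℕ) : PartialOrder (Equiv.Perm (Fin n)) where
  le := Relation.ReflTransGen BruhatStep
  le_refl _ := Relation.ReflTransGen.refl
  le_trans _ _ _ := Relation.ReflTransGen.trans
  le_antisymm x y hxy hyx := by
    rcases eq_or_inversionNumber_lt hxy with h | h
    · exact h
    · rcases eq_or_inversionNumber_lt hyx with h' | h'
      · exact h'.symm
      · omega

/-- A covering relation of the Bruhat–Chevalley order is one of the defining ones. -/
theorem BruhatStep_of_covBy {n : ℕ} {x y : Equiv.Perm (Fin n)} (h : x ⋖ y) : BruhatStep x y := by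
  have hle : Relation.ReflTransGen BruhatStep x y := h.le
  rcases Relation.ReflTransGen.cases_head hle with heq | ⟨z, hxz, hzy⟩
  · exact absurd heq h.lt.ne
  · have hxz' : x ≤ z := Relation.ReflTransGen.single hxz
    have hzy' : z ≤ y := hzy
    have hne : x ≠ z := by
      rintro rfl
      have := hxz.1
      omega
    rcases eq_or_lt_of_le hzy' with rfl | hlt
    · exact hxz
    · exact absurd hlt (h.2 (lt_of_le_of_ne hxz' hne))

/-! ### Graded and EL-shellable posets -/

/-- A (finite) poset is graded if all its maximal chains have the same length. -/
def IsGradedPoset (P : Type*) [PartialOrder P] : Prop :=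
  ∀ s t : Set P, IsMaxChain (· ≤ ·) s → IsMaxChain (· ≤ ·) t → s.ncard = t.ncard

/-- The set `C(P)` of the covering relations of `P`. -/
abbrev CoverRel (P : Type*) [PartialOrder P] : Type _ :=
  {e : P × P // e.1 ⋖ e.2}

/-- Saturated chains `x_0 ⋖ x_1 ⋖ ⋯ ⋖ x_k` of `P`. -/
abbrev SaturatedChain (P : Type*) [PartialOrder P] : Type _ :=
  RelSeries {e : P × P | e.1 ⋖ e.2}

/-- The sequence `(f(x_0, x_1), …, f(x_{k-1}, x_k))` of the labels of a saturated chain. -/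
def chainLabels {P Γ : Type*} [PartialOrder P] (f : CoverRel P → Γ) (c : SaturatedChain P) :
    List Γ :=
  List.ofFn fun i : Fin c.length => f ⟨(c i.castSucc, c i.succ), c.step i⟩

/-- `c` is the unique saturated chain from `x` to `y` with weakly increasing label sequence, and
its label sequence is lexicographically smallest among those of all saturated chains from `x` to
`y`. -/
def IsRisingChain {P Γ : Type*} [PartialOrder P] [LinearOrder Γ] (f : CoverRel P → Γ)
    (x y : P) (c : SaturatedChain P) : Prop :=
  (c.head = x ∧ c.last = y ∧ (chainLabels f c).Pairwise (· ≤ ·)) ∧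
    (∀ c' : SaturatedChain P, c'.head = x → c'.last = y →
      (chainLabels f c').Pairwise (· ≤ ·) → c' = c) ∧
    ∀ c' : SaturatedChain P, c'.head = x → c'.last = y → chainLabels f c ≤ chainLabels f c'

/-- `f` is an EL-labeling of `P`. -/
def IsELLabeling {P Γ : Type*} [PartialOrder P] [LinearOrder Γ] (f : CoverRel P → Γ) : Prop :=
  ∀ x y : P, x < y → ∃ c : SaturatedChain P, IsRisingChain f x y c

/-- `P` is EL-shellable: a finite graded poset with a minimum and a maximum which has an
EL-labeling with labels in some totally ordered set. -/
def IsELShellable (P : Type) [PartialOrder P] : Prop :=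
  Finite P ∧ IsGradedPoset P ∧ (∃ b : P, IsBot b) ∧ (∃ t : P, IsTop t) ∧
    ∃ (Γ : Type) (_ : LinearOrder Γ) (f : CoverRel P → Γ), IsELLabeling f

/-! ### The labeling of the Bruhat–Chevalley order by right multiplication -/

theorem existsUnique_label {n : ℕ} (e : CoverRel (Equiv.Perm (Fin n))) :
    ∃! p : Fin n ×ₗ Fin n, (ofLex p).1 < (ofLex p).2 ∧
      e.1.2 = e.1.1 * Equiv.swap (ofLex p).1 (ofLex p).2 := by
  obtain ⟨-, i, j, hij, -, h⟩ := BruhatStep_of_covBy e.2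
  refine ⟨toLex (i, j), ⟨hij, h⟩, ?_⟩
  rintro p ⟨hp, hp'⟩
  have hs : Equiv.swap (ofLex p).1 (ofLex p).2 = Equiv.swap i j :=
    mul_left_cancel (hp'.symm.trans h)
  have hi := congrArg (fun σ : Equiv.Perm (Fin n) => σ i) hs
  have hj := congrArg (fun σ : Equiv.Perm (Fin n) => σ j) hs
  simp only [Equiv.swap_apply_left, Equiv.swap_apply_right] at hi hj
  have key : (ofLex p).1 = i ∧ (ofLex p).2 = j := by
    rw [Equiv.swap_apply_def] at hi hj
    split_ifs at hi hj <;> constructor <;> omega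
  exact Prod.ext key.1 key.2

/-- The label of a covering relation `x ⋖ y` of the Bruhat–Chevalley order is the pair `(i, j)`,
`i < j`, with `y = x * (i j)`. Labels are ordered lexicographically. -/
noncomputable def bruhatLabel {n : ℕ} (e : CoverRel (Equiv.Perm (Fin n))) : Fin n ×ₗ Fin n :=
  (existsUnique_label e).choose

/-- The restriction of the labeling `bruhatLabel` to a subset `C` of the symmetric group all of
whose covering relations (in the induced order) are covering relations of the symmetric group. -/
noncomputable def restrictedLabel {n : ℕ} {C : Set (Equiv.Perm (Fin n))}
    (hC : ∀ x y : C, x ⋖ y → (x : Equiv.Perm (Fin n)) ⋖ (y : Equiv.Perm (Fin n)))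
    (e : CoverRel C) : Fin n ×ₗ Fin n :=
  bruhatLabel ⟨((e.1.1 : Equiv.Perm (Fin n)), (e.1.2 : Equiv.Perm (Fin n))), hC _ _ e.2⟩

/-! Cutting the one-line word along `λ` turns membership in `C_λ` into a condition on entries: each
entry that opens a block is smaller than all entries after it (`mem_omegaClass_iff`). Such blocks
form a standard cyclic form, and a standard form is recovered from the product of its cycles
(`standardCyclicForm_prod_formPerm`).

The Bruhat order is governed by `entryCount`: `x ≤ y` exactly when no count of `x` exceeds that of
`y` (`entryCount_mono`, `le_of_entryCount_le`). The second half climbs from `x` to `y` by greedy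
exchanges: at the first position `i` where they differ one has `x i < y i`, and `x i` is swapped
with the first later entry lying above `x i` and not above `y i`. The result is still dominated by
`y` (`entryCount_first_exchange`). The label of this exchange is the least possible first label
(`IsGreedyExchange.le_label`), and a rising chain must start with it (`IsGreedyExchange.label_eq`):
otherwise all its labels are larger and the entry at `i` never reaches `x j`. So the greedy chain is
the unique rising chain and lexicographically first (`exists_rising_chain`).

If `x` and `y` both satisfy the block condition, then `i` opens no block, since `x i` occurs in `y`
after `i` and is smaller than `y i`. Hence the exchange preserves the condition
(`HasBlockMinima.mul_swap`), and rising chains between elements of `C_λ` stay in `C_λ`. Therefore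
covers of `C_λ` are covers of `S_n`, the labeling restricts, and the inversion number is a rank
function.

The maximum puts the smallest entries, increasing, at the block starts and the rest in decreasing
order elsewhere; that it dominates `C_λ` is checked on counts (`le_maxWord`). -/

/-! ### Inversions under a transposition and the covers of the Bruhat order -/

section Exchange

variable {n : ℕ}

/-- The set of inversions of a permutation. -/
def inversionSet (x : Equiv.Perm (Fin n)) : Finset (Fin n × Fin n) :=
  Finset.univ.filter fun p : Fin n × Fin n => p.1 < p.2 ∧ x p.2 < x p.1

theorem card_inversionSet (x : Equiv.Perm (Fin n)) :
    (inversionSet x).card = inversionNumber x := rfl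

theorem mem_inversionSet {x : Equiv.Perm (Fin n)} {p q : Fin n} :
    (p, q) ∈ inversionSet x ↔ p < q ∧ x q < x p := by
  simp [inversionSet]

/-- Apply the transposition of `i` and `j` to both entries of a pair, unless this destroys the
order of the entries. -/
def exchangePair (i j : Fin n) (p : Fin n × Fin n) : Fin n × Fin n :=
  if Equiv.swap i j p.1 < Equiv.swap i j p.2 then (Equiv.swap i j p.1, Equiv.swap i j p.2) else p

theorem exchangePair_exchangePair (i j : Fin n) {p : Fin n × Fin n} (hp : p.1 < p.2) :
    exchangePair i j (exchangePair i j p) = p := by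
  unfold exchangePair
  by_cases h : Equiv.swap i j p.1 < Equiv.swap i j p.2
  · simp [h, hp]
  · simp [h]

/-- The only pairs whose order is destroyed by the transposition of `i < j`. -/
theorem swap_order_cases {i j p q : Fin n} (hij : i < j) (hpq : p < q)
    (h : ¬ Equiv.swap i j p < Equiv.swap i j q) :
    (p = i ∧ q = j) ∨ (p = i ∧ q < j) ∨ (i < p ∧ q = j) := by
  rw [Equiv.swap_apply_def, Equiv.swap_apply_def] at h
  split_ifs at h <;> omega

/-- When the transposition keeps the order of the pair, the same two entries are compared. Otherwise
the pair starts at `i` or ends at `j`, and the exchange raises the entry at `i` and lowers the one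
at `j`, so the inversion survives. -/
theorem exchangePair_mem {x : Equiv.Perm (Fin n)} {i j : Fin n} (hij : i < j) (hx : x i < x j)
    {p : Fin n × Fin n} (hp : p ∈ inversionSet x) :
    exchangePair i j p ∈ inversionSet (x * Equiv.swap i j) := by
  obtain ⟨p, q⟩ := p
  rw [mem_inversionSet] at hp
  unfold exchangePair
  by_cases h : Equiv.swap i j p < Equiv.swap i j q
  · simp only [h, if_true]
    rw [mem_inversionSet]
    exact ⟨h, by simpa using hp.2⟩
  · simp only [h, if_false]
    rw [mem_inversionSet]
    refine ⟨hp.1, ?_⟩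
    simp only [Equiv.Perm.mul_apply]
    rcases swap_order_cases hij hp.1 h with ⟨rfl, rfl⟩ | ⟨rfl, hq⟩ | ⟨hi, rfl⟩
    · exact absurd hp.2 hx.not_gt
    · rw [Equiv.swap_apply_left, Equiv.swap_apply_of_ne_of_ne hp.1.ne' hq.ne]
      exact hp.2.trans hx
    · rw [Equiv.swap_apply_right, Equiv.swap_apply_of_ne_of_ne hi.ne' hp.1.ne]
      exact hx.trans hp.2

theorem card_image_exchangePair (x : Equiv.Perm (Fin n)) (i j : Fin n) :
    ((inversionSet x).image (exchangePair i j)).card = inversionNumber x := by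
  rw [Finset.card_image_of_injOn, card_inversionSet]
  rintro ⟨p, q⟩ hp ⟨p', q'⟩ hp' h
  have h1 := (mem_inversionSet.1 hp).1
  have h2 := (mem_inversionSet.1 hp').1
  rw [← exchangePair_exchangePair i j (p := (p, q)) h1, h, exchangePair_exchangePair i j h2]

theorem inversionSet_image_subset {x : Equiv.Perm (Fin n)} {i j : Fin n} (hij : i < j)
    (hx : x i < x j) :
    (inversionSet x).image (exchangePair i j) ⊆ inversionSet (x * Equiv.swap i j) := by
  intro p hp
  obtain ⟨q, hq, rfl⟩ := Finset.mem_image.1 hp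
  exact exchangePair_mem hij hx hq

/-- A pair whose order is destroyed by the transposition is an exchanged inversion only if it is an
inversion. -/
theorem mem_inversionSet_of_mem_image {x : Equiv.Perm (Fin n)} {i j p q : Fin n}
    (h : (p, q) ∈ (inversionSet x).image (exchangePair i j))
    (hs : ¬ Equiv.swap i j p < Equiv.swap i j q) : x q < x p := by
  obtain ⟨r, hr, hr'⟩ := Finset.mem_image.1 h
  have h1 : exchangePair i j (p, q) = r := by
    rw [← hr', exchangePair_exchangePair]
    exact (mem_inversionSet.1 hr).1
  rw [exchangePair, if_neg hs] at h1
  rw [← h1] at hr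
  exact (mem_inversionSet.1 hr).2

/-- The exchanged inversions of `x` are as many as the inversions of `x`, and `(i, j)` is a new one.
The count grows by exactly one when there is no further new inversion. -/
theorem inversionNumber_mul_swap {x : Equiv.Perm (Fin n)} {i j : Fin n} (hij : i < j)
    (hx : x i < x j) :
    inversionNumber (x * Equiv.swap i j) = inversionNumber x + 1 ↔
      ∀ k, i < k → k < j → ¬ (x i < x k ∧ x k < x j) := by
  set S := (inversionSet x).image (exchangePair i j) with hS
  have hcard : S.card = inversionNumber x := card_image_exchangePair x i j
  have hsub : S ⊆ inversionSet (x * Equiv.swap i j) := inversionSet_image_subset hij hx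
  have hmem : (i, j) ∈ inversionSet (x * Equiv.swap i j) := by
    rw [mem_inversionSet]
    simpa using ⟨hij, hx⟩
  have hnot : (i, j) ∉ S := fun h =>
    absurd (mem_inversionSet_of_mem_image h (by simpa using hij.le)) hx.not_gt
  constructor
  -- An entry between the two in position and value makes `(i, k)` a second new inversion.
  · rintro h k hik hkj ⟨h1, h2⟩
    have hk : (i, k) ∈ inversionSet (x * Equiv.swap i j) := by
      rw [mem_inversionSet]
      refine ⟨hik, ?_⟩
      simp only [Equiv.Perm.mul_apply]
      rwa [Equiv.swap_apply_left, Equiv.swap_apply_of_ne_of_ne hik.ne' hkj.ne]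
    have hkn : (i, k) ∉ S := fun h' =>
      absurd (mem_inversionSet_of_mem_image h' (by
        rw [Equiv.swap_apply_left, Equiv.swap_apply_of_ne_of_ne hik.ne' hkj.ne]
        exact hkj.not_gt)) h1.not_gt
    have hc : (insert (i, k) (insert (i, j) S)).card = inversionNumber x + 2 := by
      rw [Finset.card_insert_of_notMem, Finset.card_insert_of_notMem hnot, hcard]
      rw [Finset.mem_insert, not_or]
      refine ⟨fun h' => hkj.ne (Prod.ext_iff.1 h').2, hkn⟩
    have hle := Finset.card_le_card
      (Finset.insert_subset hk (Finset.insert_subset hmem hsub))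
    rw [hc, card_inversionSet, h] at hle
    omega
  · intro h
    have heq : inversionSet (x * Equiv.swap i j) = insert (i, j) S := by
      refine Finset.Subset.antisymm ?_ (Finset.insert_subset hmem hsub)
      rintro ⟨p, q⟩ hp
      rw [mem_inversionSet] at hp
      obtain ⟨hpq, hp⟩ := hp
      simp only [Equiv.Perm.mul_apply] at hp
      rw [Finset.mem_insert]
      by_cases hs : Equiv.swap i j p < Equiv.swap i j q
      · right
        refine Finset.mem_image.2 ⟨(Equiv.swap i j p, Equiv.swap i j q),
          mem_inversionSet.2 ⟨hs, hp⟩, ?_⟩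
        simp [exchangePair, hpq]
      -- A pair whose order is destroyed is fixed by `exchangePair`, so it must already be an
      -- inversion of `x`; the gap condition supplies this.
      · have key : ∀ _ : x q < x p, (p, q) ∈ S := fun hlt =>
          Finset.mem_image.2 ⟨(p, q), mem_inversionSet.2 ⟨hpq, hlt⟩, by simp [exchangePair, hs]⟩
        rcases swap_order_cases hij hpq hs with ⟨rfl, rfl⟩ | ⟨rfl, hq⟩ | ⟨hi, rfl⟩
        · exact Or.inl rfl
        · right
          apply key
          rw [Equiv.swap_apply_left, Equiv.swap_apply_of_ne_of_ne hpq.ne' hq.ne] at hp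
          refine lt_of_le_of_ne (le_of_not_gt fun h' => h q hpq hq ⟨h', hp⟩) ?_
          exact fun e => hpq.ne' (x.injective e)
        · right
          apply key
          rw [Equiv.swap_apply_right, Equiv.swap_apply_of_ne_of_ne hi.ne' hpq.ne] at hp
          refine lt_of_le_of_ne (le_of_not_gt fun h' => h p hi hpq ⟨hp, h'⟩) ?_
          exact fun e => hpq.ne' (x.injective e)
    rw [← card_inversionSet, heq, Finset.card_insert_of_notMem hnot, hcard]

theorem inversionNumber_strictMono :
    StrictMono (inversionNumber : Equiv.Perm (Fin n) → ℕ) :=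
  fun _ _ h => (eq_or_inversionNumber_lt h.le).resolve_left h.ne

theorem covBy_iff_bruhatStep {x y : Equiv.Perm (Fin n)} : x ⋖ y ↔ BruhatStep x y := by
  refine ⟨BruhatStep_of_covBy, fun h => ?_⟩
  refine ⟨lt_of_le_of_ne (Relation.ReflTransGen.single h) ?_, fun z h1 h2 => ?_⟩
  · rintro rfl
    have := h.1
    omega
  · have := h.1
    have := inversionNumber_strictMono h1
    have := inversionNumber_strictMono h2
    omega

theorem inversionNumber_of_covBy {x y : Equiv.Perm (Fin n)} (h : x ⋖ y) :
    inversionNumber y = inversionNumber x + 1 :=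
  (BruhatStep_of_covBy h).1

theorem covBy_mul_swap {x : Equiv.Perm (Fin n)} {i j : Fin n} (hij : i < j) (hx : x i < x j)
    (h : ∀ k, i < k → k < j → ¬ (x i < x k ∧ x k < x j)) : x ⋖ x * Equiv.swap i j :=
  covBy_iff_bruhatStep.2 ⟨(inversionNumber_mul_swap hij hx).2 h, i, j, hij, hx, rfl⟩

theorem exists_label_of_covBy {x y : Equiv.Perm (Fin n)} (h : x ⋖ y) :
    ∃ i j, i < j ∧ x i < x j ∧ y = x * Equiv.swap i j ∧
      (∀ k, i < k → k < j → ¬ (x i < x k ∧ x k < x j)) ∧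
      bruhatLabel ⟨(x, y), h⟩ = toLex (i, j) := by
  obtain ⟨hinv, i, j, hij, hx, rfl⟩ := BruhatStep_of_covBy h
  refine ⟨i, j, hij, hx, rfl, (inversionNumber_mul_swap hij hx).1 hinv, ?_⟩
  have hu := existsUnique_label ⟨(x, x * Equiv.swap i j), h⟩
  exact hu.unique hu.choose_spec.1 ⟨hij, rfl⟩

theorem bruhatLabel_eq {x y : Equiv.Perm (Fin n)} (h : x ⋖ y) {i j : Fin n} (hij : i < j)
    (hy : y = x * Equiv.swap i j) : bruhatLabel ⟨(x, y), h⟩ = toLex (i, j) := by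
  have hu := existsUnique_label ⟨(x, y), h⟩
  exact hu.unique hu.choose_spec.1 ⟨hij, hy⟩

end Exchange

/-! ### The counting criterion for the Bruhat order -/

section Rank

variable {n : ℕ}

/-- The number of positions before `a` with entry at least `b`. -/
def entryCount (x : Equiv.Perm (Fin n)) (a b : ℕ) : ℕ :=
  (Finset.univ.filter fun c : Fin n => (c : ℕ) < a ∧ b ≤ (x c : ℕ)).card

theorem entryCount_le_mul_swap {x : Equiv.Perm (Fin n)} {i j : Fin n} (hij : i < j)
    (hx : x i < x j) (a b : ℕ) : entryCount x a b ≤ entryCount (x * Equiv.swap i j) a b := by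
  set s := Equiv.swap i j with hs
  have hss : ∀ c, s (s c) = c := fun c => by simp [hs]
  -- Each counted entry is followed to its new position if that is still before `a`. Otherwise its
  -- old position is `i`, where the new entry is larger.
  refine Finset.card_le_card_of_injOn (fun c => if (s c : ℕ) < a then s c else c) ?_ ?_
  · intro c hc
    simp only [Finset.coe_filter, Finset.mem_univ, true_and, Set.mem_ofPred_eq] at hc ⊢
    by_cases h : (s c : ℕ) < a
    · simp only [h, if_true, true_and, Equiv.Perm.mul_apply, hss]
      exact hc.2
    · simp only [h, if_false, Equiv.Perm.mul_apply]
      refine ⟨hc.1, ?_⟩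
      have hci : c = i := by
        by_contra hci
        by_cases hcj : c = j
        · rw [hcj, hs, Equiv.swap_apply_right] at h
          have : (i : ℕ) < j := hij
          rw [hcj] at hc
          omega
        · rw [hs, Equiv.swap_apply_of_ne_of_ne hci hcj] at h
          exact h hc.1
      rw [hci, hs, Equiv.swap_apply_left]
      rw [hci] at hc
      have : (x i : ℕ) < x j := hx
      omega
  · intro c hc d hd h
    simp only [Finset.coe_filter, Finset.mem_univ, true_and, Set.mem_ofPred_eq] at hc hd h
    split_ifs at h with h1 h2 h2
    · exact s.injective h
    · rw [← h, hss] at h2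
      exact absurd hc.1 h2
    · rw [h, hss] at h1
      exact absurd hd.1 h1
    · exact h

theorem entryCount_mono {x y : Equiv.Perm (Fin n)} (h : x ≤ y) (a b : ℕ) :
    entryCount x a b ≤ entryCount y a b := by
  have h' : Relation.ReflTransGen BruhatStep x y := h
  induction h' with
  | refl => exact le_rfl
  | tail _ hs ih =>
    obtain ⟨-, i, j, hij, hx, rfl⟩ := hs
    exact (ih ‹_›).trans (entryCount_le_mul_swap hij hx a b)

/-- If two permutations agree before position `i`, a comparison of counts gives a comparison of
the entries at position `i`. -/
theorem apply_le_of_entryCount_le {x y : Equiv.Perm (Fin n)} {i : Fin n}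
    (h : ∀ a b, entryCount x a b ≤ entryCount y a b) (heq : ∀ c < i, x c = y c) : x i ≤ y i := by
  by_contra hlt
  rw [not_le] at hlt
  -- With these bounds position `i` is just included, and it is counted for `x` but not for `y`.
  have h1 := h (i + 1) (x i)
  refine absurd h1 (not_le.2 (Finset.card_lt_card ?_))
  rw [Finset.ssubset_iff_of_subset]
  · refine ⟨i, by simp, ?_⟩
    simpa using hlt
  · intro c hc
    simp only [Finset.mem_filter, Finset.mem_univ, true_and] at hc ⊢
    have hci : c ≠ i := by
      rintro rfl
      have : (y c : ℕ) < x c := hlt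
      omega
    have hci' : c < i := lt_of_le_of_ne (Fin.le_def.2 (by omega)) hci
    rw [heq c hci']
    exact hc

theorem apply_le_of_le {x y : Equiv.Perm (Fin n)} {i : Fin n} (h : x ≤ y)
    (heq : ∀ c < i, x c = y c) : x i ≤ y i :=
  apply_le_of_entryCount_le (entryCount_mono h) heq

/-- Permutations in a Bruhat interval whose end points agree before position `i` agree there with
the end points. -/
theorem eq_of_mem_interval {x y z : Equiv.Perm (Fin n)} {i : Fin n} (hxz : x ≤ z) (hzy : z ≤ y)
    (heq : ∀ c < i, x c = y c) : ∀ c < i, x c = z c := by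
  intro c
  induction c using WellFoundedLT.induction with
  | ind c ih =>
    intro hc
    have h1 : ∀ d < c, x d = z d := fun d hd => ih d hd (hd.trans hc)
    refine le_antisymm (apply_le_of_le hxz h1) ?_
    rw [heq c hc]
    exact apply_le_of_le hzy fun d hd => (h1 d hd).symm.trans (heq d (hd.trans hc))

theorem exists_first_difference {x y : Equiv.Perm (Fin n)} (h : x ≠ y) :
    ∃ i, x i ≠ y i ∧ ∀ c < i, x c = y c := by
  have hne : ∃ i, x i ≠ y i := by
    by_contra hall
    push Not at hall
    exact h (Equiv.ext hall)
  obtain ⟨i, hi, hmin⟩ := WellFounded.has_min (wellFounded_lt (α := Fin n)) {i | x i ≠ y i} hne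
  exact ⟨i, hi, fun c hc => by_contra fun hne => hmin c hne hc⟩

/-- The position of the first exchange on the way from `x` up to `y`. -/
theorem exists_first_exchange {x y : Equiv.Perm (Fin n)} {i : Fin n}
    (heq : ∀ c < i, x c = y c) (hlt : x i < y i) :
    ∃ j, i < j ∧ x i < x j ∧ x j ≤ y i ∧ ∀ k, i < k → k < j → ¬ (x i < x k ∧ x k ≤ y i) := by
  have hne : {j | i < j ∧ x i < x j ∧ x j ≤ y i}.Nonempty := by
    -- The position of `y i` in `x` qualifies: it cannot precede `i`, where `x` and `y` agree.
    refine ⟨x.symm (y i), ?_, by simpa using hlt, by simp⟩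
    by_contra hle
    rw [not_lt] at hle
    rcases hle.lt_or_eq with h | h
    · have := heq _ h
      rw [Equiv.apply_symm_apply] at this
      exact h.ne' (y.injective this)
    · have : x i = y i := by rw [← h, Equiv.apply_symm_apply, h]
      exact hlt.ne this
  obtain ⟨j, ⟨h1, h2, h3⟩, hmin⟩ := WellFounded.has_min (wellFounded_lt (α := Fin n)) _ hne
  exact ⟨j, h1, h2, h3, fun k hik hkj hk => hmin k ⟨hik, hk⟩ hkj⟩

/-- The exchange can raise a count only for `i < a ≤ j` and `x i < b ≤ x j`. There the large entries
are split at the value `y i`: by the gap condition, those up to `y i` sit at `i` or at earlier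
positions, where `x` and `y` agree, and those above `y i` are bounded by the hypothesis at threshold
`y i + 1`. -/
theorem entryCount_first_exchange {x y : Equiv.Perm (Fin n)} {i j : Fin n}
    (h : ∀ a b, entryCount x a b ≤ entryCount y a b) (heq : ∀ c < i, x c = y c)
    (hij : i < j) (hx : x i < x j) (hj : x j ≤ y i)
    (hmin : ∀ k, i < k → k < j → ¬ (x i < x k ∧ x k ≤ y i)) (a b : ℕ) :
    entryCount (x * Equiv.swap i j) a b ≤ entryCount y a b := by
  set s := Equiv.swap i j with hs
  have hss : ∀ c, s (s c) = c := fun c => by simp [hs]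
  have hij' : (i : ℕ) < j := hij
  have hx' : (x i : ℕ) < x j := hx
  have hj' : (x j : ℕ) ≤ y i := hj
  have hsi : s i = j := by simp [hs]
  have hsj : s j = i := by simp [hs]
  have hsk : ∀ k, k ≠ i → k ≠ j → s k = k := fun k h1 h2 => Equiv.swap_apply_of_ne_of_ne h1 h2
  by_cases hcase : (i : ℕ) < a ∧ a ≤ j ∧ (x i : ℕ) < b ∧ b ≤ x j
  · obtain ⟨h1, h2, h3, h4⟩ := hcase
    have hA : entryCount (x * s) a b ≤
        (Finset.univ.filter fun c : Fin n =>
          c < i ∧ b ≤ (x c : ℕ) ∧ (x c : ℕ) ≤ y i).card + 1 + entryCount x a (y i + 1) := by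
      have : (Finset.univ.filter fun c : Fin n => (c : ℕ) < a ∧ b ≤ ((x * s) c : ℕ)) ⊆
          insert i (Finset.univ.filter fun c : Fin n =>
            c < i ∧ b ≤ (x c : ℕ) ∧ (x c : ℕ) ≤ y i) ∪
          (Finset.univ.filter fun c : Fin n => (c : ℕ) < a ∧ (y i + 1 : ℕ) ≤ (x c : ℕ)) := by
        intro c hc
        obtain ⟨hca, hcb⟩ := (Finset.mem_filter.1 hc).2
        rw [Equiv.Perm.mul_apply] at hcb
        simp only [Finset.mem_filter, Finset.mem_univ, true_and,
          Finset.mem_union, Finset.mem_insert]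
        by_cases hci : c = i
        · exact Or.inl (Or.inl hci)
        · have hcj : c ≠ j := by
            rintro rfl
            omega
          rw [hsk c hci hcj] at hcb
          by_cases hle : (x c : ℕ) ≤ y i
          · refine Or.inl (Or.inr ⟨?_, hcb, hle⟩)
            by_contra hic
            have hic' : i < c := lt_of_le_of_ne (not_lt.1 hic) (Ne.symm hci)
            refine hmin c hic' (Fin.lt_def.2 (by omega)) ⟨Fin.lt_def.2 (by omega), hle⟩
          · exact Or.inr ⟨hca, by omega⟩
      refine (Finset.card_le_card this).trans ((Finset.card_union_le _ _).trans ?_)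
      gcongr
      · exact Finset.card_insert_le _ _
      · exact le_rfl
    have hB : (Finset.univ.filter fun c : Fin n =>
          c < i ∧ b ≤ (x c : ℕ) ∧ (x c : ℕ) ≤ y i).card + 1 + entryCount y a (y i + 1) ≤
          entryCount y a b := by
      rw [← Finset.card_insert_of_notMem (a := i) (by simp)]
      unfold entryCount
      rw [← Finset.card_union_of_disjoint]
      · refine Finset.card_le_card ?_
        intro c hc
        simp only [Finset.mem_filter, Finset.mem_univ, true_and,
          Finset.mem_union, Finset.mem_insert] at hc ⊢
        rcases hc with (rfl | ⟨hc1, hc2, hc3⟩) | ⟨hc1, hc2⟩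
        · exact ⟨h1, by omega⟩
        · rw [← heq c hc1]
          have : (c : ℕ) < i := hc1
          exact ⟨by omega, hc2⟩
        · exact ⟨hc1, by omega⟩
      · rw [Finset.disjoint_left]
        intro c hc hc'
        simp only [Finset.mem_filter, Finset.mem_univ, true_and, Finset.mem_insert] at hc hc'
        rcases hc with rfl | ⟨hc1, hc2, hc3⟩
        · omega
        · rw [heq c hc1] at hc3
          omega
    have := h a (y i + 1)
    omega
  -- Outside the critical window the count does not grow: the positions are permuted if both lie
  -- before `a`, and kept otherwise.
  · refine le_trans ?_ (h a b)
    refine Finset.card_le_card_of_injOn (fun c => if (j : ℕ) < a then s c else c) ?_ ?_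
    · intro c hc
      obtain ⟨hca, hcb⟩ := (Finset.mem_filter.1 hc).2
      rw [Equiv.Perm.mul_apply] at hcb
      simp only [Finset.coe_filter, Finset.mem_univ, true_and, Set.mem_ofPred_eq]
      by_cases hja : (j : ℕ) < a
      · simp only [hja, if_true]
        refine ⟨?_, hcb⟩
        by_cases hci : c = i
        · rwa [hci, hsi]
        · by_cases hcj : c = j
          · rw [hcj, hsj]
            omega
          · rwa [hsk c hci hcj]
      · simp only [hja, if_false]
        refine ⟨hca, ?_⟩
        have hcj : c ≠ j := by
          rintro rfl
          exact hja hca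
        by_cases hci : c = i
        · rw [hci] at hca hcb ⊢
          rw [hsi] at hcb
          omega
        · rwa [hsk c hci hcj] at hcb
    · intro c _ d _ hcd
      simp only at hcd
      split_ifs at hcd
      · exact s.injective hcd
      · exact hcd

/-- `i` is the first position where `x` and `y` differ, and `j` is the first position after `i`
whose entry in `x` lies above `x i` and not above `y i`. -/
structure IsGreedyExchange (x y : Equiv.Perm (Fin n)) (i j : Fin n) : Prop where
  agree : ∀ c < i, x c = y c
  pos_lt : i < j
  lt : x i < x j
  le : x j ≤ y i
  gap : ∀ k, i < k → k < j → ¬ (x i < x k ∧ x k ≤ y i)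

theorem exists_isGreedyExchange {x y : Equiv.Perm (Fin n)}
    (h : ∀ a b, entryCount x a b ≤ entryCount y a b) (hne : x ≠ y) :
    ∃ i j, IsGreedyExchange x y i j := by
  obtain ⟨i, hi, heq⟩ := exists_first_difference hne
  obtain ⟨j, h1, h2, h3, h4⟩ :=
    exists_first_exchange heq (lt_of_le_of_ne (apply_le_of_entryCount_le h heq) hi)
  exact ⟨i, j, heq, h1, h2, h3, h4⟩

theorem IsGreedyExchange.no_between {x y : Equiv.Perm (Fin n)} {i j : Fin n}
    (h : IsGreedyExchange x y i j) (k : Fin n) (hik : i < k) (hkj : k < j) :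
    ¬ (x i < x k ∧ x k < x j) :=
  fun hk => h.gap k hik hkj ⟨hk.1, hk.2.le.trans h.le⟩

theorem IsGreedyExchange.covBy {x y : Equiv.Perm (Fin n)} {i j : Fin n}
    (h : IsGreedyExchange x y i j) : x ⋖ x * Equiv.swap i j :=
  covBy_mul_swap h.pos_lt h.lt h.no_between

/-- The comparison of counts implies the Bruhat order. -/
theorem le_of_entryCount_le {x y : Equiv.Perm (Fin n)}
    (h : ∀ a b, entryCount x a b ≤ entryCount y a b) : x ≤ y := by
  induction x using WellFoundedGT.induction with
  | ind x ih =>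
    by_cases hxy : x = y
    · exact hxy.le
    · obtain ⟨i, j, hg⟩ := exists_isGreedyExchange h hxy
      exact hg.covBy.le.trans (ih _ hg.covBy.lt
        (entryCount_first_exchange h hg.agree hg.pos_lt hg.lt hg.le hg.gap))

theorem IsGreedyExchange.mul_swap_le {x y : Equiv.Perm (Fin n)} {i j : Fin n}
    (h : IsGreedyExchange x y i j) (hxy : x ≤ y) : x * Equiv.swap i j ≤ y :=
  le_of_entryCount_le
    (entryCount_first_exchange (entryCount_mono hxy) h.agree h.pos_lt h.lt h.le h.gap)

/-- Lets counts of large entries be compared through the complementary counts of small entries. -/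
theorem card_lt_add_entryCount (z : Equiv.Perm (Fin n)) (a b : ℕ) :
    (Finset.univ.filter fun c : Fin n => (c : ℕ) < a ∧ (z c : ℕ) < b).card + entryCount z a b =
      (Finset.univ.filter fun c : Fin n => (c : ℕ) < a).card := by
  rw [entryCount, ← Finset.card_union_of_disjoint]
  · congr 1
    ext c
    simp only [Finset.mem_union, Finset.mem_filter, Finset.mem_univ, true_and]
    omega
  · rw [Finset.disjoint_left]
    intro c
    simp only [Finset.mem_filter, Finset.mem_univ, true_and]
    omega

theorem one_le_perm (x : Equiv.Perm (Fin n)) : 1 ≤ x := by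
  refine le_of_entryCount_le fun a b => ?_
  by_cases hab : a ≤ b
  · have : entryCount (1 : Equiv.Perm (Fin n)) a b = 0 := by
      rw [entryCount, Finset.card_eq_zero, Finset.filter_eq_empty_iff]
      intro c _
      simp only [Equiv.Perm.coe_one, id]
      omega
    omega
  · have h1 := card_lt_add_entryCount (1 : Equiv.Perm (Fin n)) a b
    have h2 := card_lt_add_entryCount x a b
    have h3 : (Finset.univ.filter fun c : Fin n => (c : ℕ) < a ∧ (x c : ℕ) < b).card ≤
        (Finset.univ.filter fun c : Fin n =>
          (c : ℕ) < a ∧ ((1 : Equiv.Perm (Fin n)) c : ℕ) < b).card := by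
      refine Finset.card_le_card_of_injOn x ?_ x.injective.injOn
      intro c hc
      have hc' := (Finset.mem_filter.1 hc).2
      refine Finset.mem_coe.2 (Finset.mem_filter.2 ⟨Finset.mem_univ _, ?_⟩)
      simp only [Equiv.Perm.coe_one, id]
      omega
    omega

end Rank

/-! ### Label sequences and the greedy rising chain -/

section Chains

variable {n : ℕ}

/-- `LabelChain x l y` means that `l` is the label sequence of a saturated chain from `x` to `y`. -/
inductive LabelChain : Equiv.Perm (Fin n) → List (Fin n ×ₗ Fin n) → Equiv.Perm (Fin n) → Prop
  | nil (x : Equiv.Perm (Fin n)) : LabelChain x [] x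
  | cons {x y : Equiv.Perm (Fin n)} {i j : Fin n} {l : List (Fin n ×ₗ Fin n)} (hij : i < j)
      (hx : x i < x j) (hgap : ∀ k, i < k → k < j → ¬ (x i < x k ∧ x k < x j))
      (h : LabelChain (x * Equiv.swap i j) l y) : LabelChain x (toLex (i, j) :: l) y

theorem LabelChain.le {x y : Equiv.Perm (Fin n)} {l : List (Fin n ×ₗ Fin n)}
    (h : LabelChain x l y) : x ≤ y := by
  induction h with
  | nil => exact le_rfl
  | cons hij hx hgap _ ih => exact (covBy_mul_swap hij hx hgap).le.trans ih

theorem LabelChain.eq_nil {x : Equiv.Perm (Fin n)} {l : List (Fin n ×ₗ Fin n)}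
    (h : LabelChain x l x) : l = [] := by
  cases h with
  | nil => rfl
  | cons hij hx hgap h => exact absurd h.le (covBy_mul_swap hij hx hgap).lt.not_ge

theorem LabelChain.apply_eq {x y : Equiv.Perm (Fin n)} {l : List (Fin n ×ₗ Fin n)}
    (h : LabelChain x l y) {i : Fin n} (hl : ∀ p ∈ l, i < (ofLex p).1) : y i = x i := by
  induction h with
  | nil => rfl
  | @cons x y a b l hij hx hgap h ih =>
    rw [ih fun p hp => hl p (List.mem_cons_of_mem _ hp)]
    have ha : i < a := hl _ List.mem_cons_self
    rw [Equiv.Perm.mul_apply, Equiv.swap_apply_of_ne_of_ne ha.ne (ha.trans hij).ne]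

/-- A label larger than `(i, j)` that still moves position `i` is some `(i, b)` with `j < b`.
Position `j` is then passed over, so the gap condition forbids the entry at `i` to jump above the
one at `j`. Once a first coordinate exceeds `i`, weak increase freezes position `i`. -/
theorem LabelChain.apply_lt {z y : Equiv.Perm (Fin n)} {l : List (Fin n ×ₗ Fin n)}
    (h : LabelChain z l y) (hl : l.Pairwise (· ≤ ·)) {i j : Fin n} (hij : i < j)
    (hlt : ∀ p ∈ l, toLex (i, j) < p) (hz : z i < z j) : y i < z j := by
  induction h with
  | nil => exact hz
  | @cons z y a b l hab hx hgap h ih =>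
    rw [List.pairwise_cons] at hl
    have h1 := hlt _ List.mem_cons_self
    rw [Prod.Lex.toLex_lt_toLex] at h1
    rcases h1 with h1 | ⟨h1, h2⟩
    · have : y i = z i := by
        refine LabelChain.apply_eq (LabelChain.cons hab hx hgap h) fun p hp => ?_
        rcases List.mem_cons.1 hp with rfl | hp
        · exact h1
        · have h3 := hl.1 p hp
          rw [Prod.Lex.le_iff] at h3
          rcases h3 with h3 | h3
          · exact lt_trans h1 h3
          · exact lt_of_lt_of_eq h1 h3.1
      rwa [this]
    · simp only at h1 h2
      subst h1
      have hj : (z * Equiv.swap i b) j = z j := by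
        rw [Equiv.Perm.mul_apply, Equiv.swap_apply_of_ne_of_ne hij.ne' h2.ne]
      have hi : (z * Equiv.swap i b) i = z b := by
        rw [Equiv.Perm.mul_apply, Equiv.swap_apply_left]
      rw [← hj]
      refine ih hl.2 (fun p hp => hlt p (List.mem_cons_of_mem _ hp)) ?_
      rw [hi, hj]
      refine lt_of_le_of_ne (le_of_not_gt fun h3 => hgap j hij h2 ⟨hz, h3⟩) ?_
      exact fun e => h2.ne' (z.injective e)

/-- The whole interval agrees with its end points before `i`, so no exchange can start earlier; an
exchange at `i` cannot overshoot `y i`. -/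
theorem LabelChain.le_first {x y : Equiv.Perm (Fin n)} {l : List (Fin n ×ₗ Fin n)} {i a b : Fin n}
    (h : LabelChain x (toLex (a, b) :: l) y) (heq : ∀ c < i, x c = y c) :
    i ≤ a ∧ a < b ∧ x a < x b ∧ (a = i → x b ≤ y i) := by
  cases h with
  | cons hij hx hgap h =>
    have h1 : x ≤ x * Equiv.swap a b := (covBy_mul_swap hij hx hgap).le
    have h2 := eq_of_mem_interval h1 h.le heq
    refine ⟨?_, hij, hx, ?_⟩
    · by_contra hai
      have h3 := h2 a (not_le.1 hai)
      rw [Equiv.Perm.mul_apply, Equiv.swap_apply_left] at h3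
      exact hx.ne h3
    · rintro rfl
      have h3 := apply_le_of_le h.le fun c hc => (h2 c hc).symm.trans (heq c hc)
      rwa [Equiv.Perm.mul_apply, Equiv.swap_apply_left] at h3

theorem IsGreedyExchange.le_label {x y : Equiv.Perm (Fin n)} {i j a b : Fin n}
    (hg : IsGreedyExchange x y i j) {l : List (Fin n ×ₗ Fin n)}
    (h : LabelChain x (toLex (a, b) :: l) y) : toLex (i, j) ≤ toLex (a, b) := by
  obtain ⟨h1, h2, h3, h4⟩ := h.le_first hg.agree
  rw [Prod.Lex.toLex_le_toLex]
  rcases h1.lt_or_eq with h1 | rfl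
  · exact Or.inl h1
  · refine Or.inr ⟨rfl, not_lt.1 fun hb => ?_⟩
    exact hg.gap b h2 hb ⟨h3, h4 rfl⟩

/-- This makes the greedy chain rising: a next exchange at `i` with an earlier partner than `j`
would have been available as the greedy choice already. -/
theorem IsGreedyExchange.le_label_next {x y : Equiv.Perm (Fin n)} {i j a b : Fin n}
    (hg : IsGreedyExchange x y i j) {l : List (Fin n ×ₗ Fin n)}
    (h : LabelChain (x * Equiv.swap i j) (toLex (a, b) :: l) y) :
    toLex (i, j) ≤ toLex (a, b) := by
  have hagree : ∀ c < i, (x * Equiv.swap i j) c = y c := fun c hc => by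
    rw [Equiv.Perm.mul_apply, Equiv.swap_apply_of_ne_of_ne hc.ne (hc.trans hg.pos_lt).ne]
    exact hg.agree c hc
  obtain ⟨h1, h2, h3, h4⟩ := h.le_first hagree
  rw [Prod.Lex.toLex_le_toLex]
  rcases h1.lt_or_eq with h1 | rfl
  · exact Or.inl h1
  · refine Or.inr ⟨rfl, not_lt.1 fun hb => ?_⟩
    have h5 := h4 rfl
    rw [Equiv.Perm.mul_apply, Equiv.Perm.mul_apply, Equiv.swap_apply_left,
      Equiv.swap_apply_of_ne_of_ne h2.ne' hb.ne] at h3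
    rw [Equiv.Perm.mul_apply, Equiv.swap_apply_of_ne_of_ne h2.ne' hb.ne] at h5
    exact hg.gap b h2 hb ⟨hg.lt.trans h3, h5⟩

/-- If the first label were larger than `(i, j)`, all labels would be, and the final entry at `i`
would stay below `x j`, which is at most `y i`. -/
theorem IsGreedyExchange.label_eq {x y : Equiv.Perm (Fin n)} {i j a b : Fin n}
    (hg : IsGreedyExchange x y i j) {l : List (Fin n ×ₗ Fin n)}
    (h : LabelChain x (toLex (a, b) :: l) y) (hl : (toLex (a, b) :: l).Pairwise (· ≤ ·)) :
    toLex (a, b) = toLex (i, j) := by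
  rcases (hg.le_label h).lt_or_eq with hlt | heq
  · refine absurd (h.apply_lt hl hg.pos_lt (fun p hp => ?_) hg.lt) hg.le.not_gt
    rcases List.mem_cons.1 hp with rfl | hp
    · exact hlt
    · exact hlt.trans_le ((List.pairwise_cons.1 hl).1 p hp)
  · exact heq.symm

theorem chainLabels_of_length_ne_zero {P Γ : Type*} [PartialOrder P] (f : CoverRel P → Γ)
    (c : SaturatedChain P) (hc : c.length ≠ 0) :
    ∃ h : c.head ⋖ (c.tail hc).head,
      chainLabels f c = f ⟨(c.head, (c.tail hc).head), h⟩ :: chainLabels f (c.tail hc) := by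
  obtain ⟨len, g, step⟩ := c
  cases len with
  | zero => exact absurd rfl hc
  | succ m =>
    refine ⟨step 0, ?_⟩
    simp only [chainLabels]
    rw [List.ofFn_succ]
    rfl

theorem chainLabels_cons {P Γ : Type*} [PartialOrder P] (f : CoverRel P → Γ)
    (c : SaturatedChain P) (x : P) (h : x ⋖ c.head) :
    chainLabels f (c.cons x h) = f ⟨(x, c.head), h⟩ :: chainLabels f c := by
  obtain ⟨h', heq⟩ := chainLabels_of_length_ne_zero f (c.cons x h) (by simp)
  rw [heq]
  congr 1
  simp

theorem chainLabels_of_length_eq_zero {P Γ : Type*} [PartialOrder P] (f : CoverRel P → Γ)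
    (c : SaturatedChain P) (hc : c.length = 0) : chainLabels f c = [] := by
  simp [chainLabels, hc]

theorem labelChain_chainLabels (c : SaturatedChain (Equiv.Perm (Fin n))) :
    LabelChain c.head (chainLabels bruhatLabel c) c.last := by
  induction c using RelSeries.inductionOn with
  | singleton x =>
    rw [chainLabels_of_length_eq_zero _ _ rfl]
    exact LabelChain.nil x
  | cons c x h ih =>
    rw [chainLabels_cons, RelSeries.head_cons, RelSeries.last_cons]
    obtain ⟨i, j, hij, hx, heq, hgap, hlab⟩ := exists_label_of_covBy h
    rw [hlab]
    refine LabelChain.cons hij hx hgap ?_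
    rwa [← heq]

/-- A saturated chain is determined by its first element and its labels. -/
theorem chain_eq_of_labels {c d : SaturatedChain (Equiv.Perm (Fin n))} (hhead : c.head = d.head)
    (hl : chainLabels bruhatLabel c = chainLabels bruhatLabel d) : c = d := by
  induction c using RelSeries.inductionOn generalizing d with
  | singleton x =>
    have hd : d.length = 0 := by
      have := congrArg List.length hl
      simpa [chainLabels] using this.symm
    obtain ⟨len, g, step⟩ := d
    obtain rfl : len = 0 := hd
    refine RelSeries.ext rfl ?_
    funext k
    obtain rfl := Fin.fin_one_eq_zero k
    exact hhead
  | cons c x h ih =>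
    have hd : d.length ≠ 0 := by
      have := congrArg List.length hl
      simp only [chainLabels, List.length_ofFn, RelSeries.cons_length] at this
      omega
    obtain ⟨h', heq⟩ := chainLabels_of_length_ne_zero bruhatLabel d hd
    rw [chainLabels_cons, heq, List.cons.injEq] at hl
    obtain ⟨i, j, hij, -, e1, -, l1⟩ := exists_label_of_covBy h
    obtain ⟨i', j', -, -, e2, -, l2⟩ := exists_label_of_covBy h'
    rw [l1, l2] at hl
    have hij' : (i, j) = (i', j') := toLex.injective hl.1
    rw [Prod.mk.injEq] at hij'
    rw [RelSeries.head_cons] at hhead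
    have := ih (d := d.tail hd) (by
      rw [e2, ← hhead, ← hij'.1, ← hij'.2]
      exact e1) hl.2
    subst this hhead
    exact RelSeries.cons_self_tail hd

theorem forall_mem_cons {P : Type*} [PartialOrder P] {c : SaturatedChain P} {x : P}
    {h : x ⋖ c.head} {S : Set P} (hx : x ∈ S) (hc : ∀ i, c i ∈ S) (i) :
    (c.cons x h) i ∈ S := by
  have hi : (c.cons x h) i ∈ (c.cons x h).toList := RelSeries.mem_toList.2 ⟨i, rfl⟩
  rw [RelSeries.toList_cons, List.mem_cons] at hi
  rcases hi with hi | hi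
  · rwa [hi]
  · obtain ⟨k, hk⟩ := RelSeries.mem_toList.1 hi
    rw [← hk]
    exact hc k

/-- The greedy chain is the unique rising chain, its label sequence is lexicographically smallest,
and it stays in each set that is closed under greedy exchanges. -/
theorem exists_rising_chain {x y : Equiv.Perm (Fin n)} (hxy : x ≤ y) :
    ∃ c : SaturatedChain (Equiv.Perm (Fin n)), c.head = x ∧ c.last = y ∧
      (chainLabels bruhatLabel c).Pairwise (· ≤ ·) ∧
      (∀ l, LabelChain x l y → l.Pairwise (· ≤ ·) → l = chainLabels bruhatLabel c) ∧
      (∀ l, LabelChain x l y → chainLabels bruhatLabel c ≤ l) ∧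
      ∀ S : Set (Equiv.Perm (Fin n)), x ∈ S →
        (∀ z ∈ S, ∀ i j, IsGreedyExchange z y i j → z * Equiv.swap i j ∈ S) → ∀ i, c i ∈ S := by
  induction x using WellFoundedGT.induction with
  | ind x ih =>
    by_cases hne : x = y
    · subst hne
      refine ⟨RelSeries.singleton _ x, rfl, rfl, ?_⟩
      rw [chainLabels_of_length_eq_zero _ _ rfl]
      refine ⟨List.Pairwise.nil, fun l hl _ => hl.eq_nil, fun l hl => ?_, fun S hS _ i => hS⟩
      rw [hl.eq_nil]
    · obtain ⟨i, j, hg⟩ := exists_isGreedyExchange (entryCount_mono hxy) hne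
      obtain ⟨c, hc, rfl, hrise, huniq, hlex, hmem⟩ := ih _ hg.covBy.lt (hg.mul_swap_le hxy)
      have hcov : x ⋖ c.head := by
        rw [hc]
        exact hg.covBy
      have hchain := labelChain_chainLabels c
      have hlab : chainLabels bruhatLabel (c.cons x hcov) =
          toLex (i, j) :: chainLabels bruhatLabel c := by
        rw [chainLabels_cons, bruhatLabel_eq hcov hg.pos_lt hc]
      refine ⟨c.cons x hcov, rfl, RelSeries.last_cons .., ?_⟩
      rw [hlab]
      refine ⟨?_, ?_, ?_, ?_⟩
      · rw [hc] at hchain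
        generalize chainLabels bruhatLabel c = l at hchain hrise
        rw [List.pairwise_cons]
        refine ⟨fun p hp => ?_, hrise⟩
        cases l with
        | nil => simp at hp
        | cons q l =>
          have hq : toLex (i, j) ≤ q := hg.le_label_next (a := (ofLex q).1) (b := (ofLex q).2) hchain
          rcases List.mem_cons.1 hp with rfl | hp
          · exact hq
          · exact hq.trans ((List.pairwise_cons.1 hrise).1 p hp)
      · intro l hl hlr
        cases hl with
        | nil => exact absurd rfl hne
        | @cons _ _ a b l hab hx hgap h =>
          have heq := hg.label_eq (LabelChain.cons hab hx hgap h) hlr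
          have heq' : (a, b) = (i, j) := toLex.injective heq
          rw [Prod.mk.injEq] at heq'
          obtain ⟨rfl, rfl⟩ := heq'
          rw [huniq l h (List.pairwise_cons.1 hlr).2]
      · intro l hl
        cases hl with
        | nil => exact absurd rfl hne
        | @cons _ _ a b l hab hx hgap h =>
          rcases (hg.le_label (LabelChain.cons hab hx hgap h)).lt_or_eq with hlt | heq
          · exact le_of_lt (List.Lex.rel hlt)
          · have heq' : (i, j) = (a, b) := toLex.injective heq
            rw [Prod.mk.injEq] at heq'
            obtain ⟨rfl, rfl⟩ := heq'
            exact List.cons_le_cons _ (hlex l h)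
      · intro S hS hclosed
        exact forall_mem_cons hS (hmem S (hclosed x hS i j hg) hclosed)

theorem exists_isRisingChain {x y : Equiv.Perm (Fin n)} (hxy : x ≤ y)
    {S : Set (Equiv.Perm (Fin n))} (hx : x ∈ S)
    (hS : ∀ z ∈ S, ∀ i j, IsGreedyExchange z y i j → z * Equiv.swap i j ∈ S) :
    ∃ c : SaturatedChain (Equiv.Perm (Fin n)), IsRisingChain bruhatLabel x y c ∧ ∀ i, c i ∈ S := by
  obtain ⟨c, h1, h2, h3, h4, h5, h6⟩ := exists_rising_chain hxy
  refine ⟨c, ⟨⟨h1, h2, h3⟩, fun c' hh hl hr => ?_, fun c' hh hl => h5 _ ?_⟩, h6 S hx hS⟩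
  · have hc' := labelChain_chainLabels c'
    rw [hh, hl] at hc'
    exact chain_eq_of_labels (hh.trans h1.symm) (h4 _ hc' hr)
  · have hc' := labelChain_chainLabels c'
    rwa [hh, hl] at hc'

end Chains

/-! ### Passing to subsets closed under rising chains -/

section InducedOrder

variable {n : ℕ}

/-- A set of permutations which with two comparable elements contains a saturated chain of the
symmetric group between them. -/
def IsChainClosed (C : Set (Equiv.Perm (Fin n))) : Prop :=
  ∀ x ∈ C, ∀ y ∈ C, x < y →
    ∃ c : SaturatedChain (Equiv.Perm (Fin n)), IsRisingChain bruhatLabel x y c ∧ ∀ i, c i ∈ C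

/-- The second element of the rising chain lies in `C`, above `x` and not above `y` strictly; being
a cover in `C` forces it to be `y`. -/
theorem IsChainClosed.covBy {C : Set (Equiv.Perm (Fin n))} (hC : IsChainClosed C) (x y : C)
    (h : x ⋖ y) : (x : Equiv.Perm (Fin n)) ⋖ (y : Equiv.Perm (Fin n)) := by
  obtain ⟨c, ⟨⟨h1, h2, -⟩, -⟩, hmem⟩ := hC x x.2 y y.2 h.lt
  have hlen : c.length ≠ 0 := by
    intro h0
    obtain ⟨len, g, step⟩ := c
    obtain rfl : len = 0 := h0
    exact h.lt.ne (Subtype.ext (h1.symm.trans h2))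
  obtain ⟨hcov, -⟩ := chainLabels_of_length_ne_zero bruhatLabel c hlen
  have hle : (c.tail hlen).head ≤ (y : Equiv.Perm (Fin n)) := by
    rw [← h2, ← RelSeries.last_tail c hlen]
    exact (labelChain_chainLabels _).le
  rw [h1] at hcov
  have hz : (c.tail hlen).head ∈ C := by
    rw [RelSeries.head_tail]
    exact hmem 1
  rcases hle.lt_or_eq with hlt | heq
  · exact absurd (show (⟨_, hz⟩ : C) < y from hlt) (h.2 (show x < ⟨_, hz⟩ from hcov.lt))
  · rwa [heq] at hcov

/-- The rising chain lifts to `C`, and chains of `C` are chains of `S_n` with the same labels, so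
uniqueness and minimality carry over. -/
theorem IsChainClosed.isELLabeling {C : Set (Equiv.Perm (Fin n))} (hC : IsChainClosed C) :
    IsELLabeling (restrictedLabel hC.covBy) := by
  intro x y hxy
  obtain ⟨c, ⟨⟨h1, h2, h3⟩, h4, h5⟩, hmem⟩ := hC x x.2 y y.2 hxy
  let lift : SaturatedChain C :=
    { length := c.length
      toFun := fun i => ⟨c i, hmem i⟩
      step := fun i => ⟨(c.step i).1, fun z hz hz' => (c.step i).2 hz hz'⟩ }
  let incl : SaturatedChain C → SaturatedChain (Equiv.Perm (Fin n)) := fun d =>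
    { length := d.length
      toFun := fun i => d i
      step := fun i => hC.covBy _ _ (d.step i) }
  have hincl : ∀ d : SaturatedChain C,
      chainLabels bruhatLabel (incl d) = chainLabels (restrictedLabel hC.covBy) d := fun d => rfl
  have hlift : chainLabels (restrictedLabel hC.covBy) lift = chainLabels bruhatLabel c := rfl
  refine ⟨lift, ⟨Subtype.ext h1, Subtype.ext h2, ?_⟩, fun d hd hd' hr => ?_, fun d hd hd' => ?_⟩
  · rwa [hlift]
  · rw [← hincl] at hr
    have := h4 (incl d) (congrArg Subtype.val hd) (congrArg Subtype.val hd') hr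
    subst this
    rfl
  · rw [hlift, ← hincl]
    exact h5 (incl d) (congrArg Subtype.val hd) (congrArg Subtype.val hd')

/-- The rank function maps a maximal chain bijectively onto `0, …, rk t`: a missing value would lie
strictly between the ranks of two neighbours of the chain, which by maximality form a cover. -/
theorem ncard_of_isMaxChain {P : Type*} [PartialOrder P] [Finite P] (rk : P → ℕ)
    (hmono : StrictMono rk) (hcov : ∀ x y, x ⋖ y → rk y = rk x + 1) {b t : P} (hb : IsBot b)
    (hrb : rk b = 0) (ht : IsTop t) {s : Set P} (hs : IsMaxChain (· ≤ ·) s) :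
    s.ncard = rk t + 1 := by
  have hmem : ∀ z, (∀ u ∈ s, u ≤ z ∨ z ≤ u) → z ∈ s := by
    intro z hz
    have h1 : IsChain (· ≤ ·) (insert z s) := hs.1.insert fun u hu _ => (hz u hu).symm
    rw [hs.2 h1 (Set.subset_insert z s)]
    exact Set.mem_insert z s
  have hinj : Set.InjOn rk s := by
    intro u hu v hv h
    rcases hs.1.total hu hv with huv | huv
    · exact huv.eq_of_not_lt fun hlt => (hmono hlt).ne h
    · exact (huv.eq_of_not_lt fun hlt => (hmono hlt).ne' h).symm
  have himage : rk '' s = Set.Iic (rk t) := by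
    refine Set.Subset.antisymm ?_ ?_
    · rintro _ ⟨u, -, rfl⟩
      exact hmono.monotone (ht u)
    · intro r hr
      have hr' : r ≤ rk t := hr
      by_contra hnot
      have hfin : ({u ∈ s | rk u ≤ r}).Finite := Set.toFinite _
      -- `x` and `y` are the elements of the chain next to the missing rank `r`, from below and from
      -- above.
      obtain ⟨x, ⟨hxs, hxr⟩, hxmax⟩ := Set.exists_max_image _ rk hfin
        ⟨b, hmem b fun u _ => Or.inr (hb u), by rw [hrb]; exact Nat.zero_le r⟩
      have hxlt : rk x < r := lt_of_le_of_ne hxr fun h => hnot ⟨x, hxs, h⟩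
      have hts : t ∈ s := hmem t fun u _ => Or.inl (ht u)
      obtain ⟨y, ⟨hys, hyr⟩, hymin⟩ := Set.exists_min_image {u ∈ s | r < rk u} rk
        (Set.toFinite _) ⟨t, hts, lt_of_le_of_ne hr' fun h => hnot ⟨t, hts, h.symm⟩⟩
      have hle : ∀ u ∈ s, ∀ v ∈ s, rk u ≤ rk v → u ≤ v := by
        intro u hu v hv h
        rcases hs.1.total hu hv with huv | huv
        · exact huv
        · exact (huv.eq_of_not_lt fun hlt => (hmono hlt).not_ge h).ge
      have hxy : x < y := lt_of_le_of_ne (hle x hxs y hys (by omega)) fun h => by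
        rw [h] at hxlt
        omega
      have hcxy : x ⋖ y := by
        refine ⟨hxy, fun z hxz hzy => ?_⟩
        have hzs : z ∈ s := by
          refine hmem z fun u hu => ?_
          rcases le_or_gt (rk u) r with hur | hur
          · exact Or.inl ((hle u hu x hxs (hxmax u ⟨hu, hur⟩)).trans hxz.le)
          · exact Or.inr (hzy.le.trans (hle y hys u hu (hymin u ⟨hu, hur⟩)))
        rcases le_or_gt (rk z) r with hzr | hzr
        · exact (hmono hxz).not_ge (hxmax z ⟨hzs, hzr⟩)
        · exact (hmono hzy).not_ge (hymin z ⟨hzs, hzr⟩)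
      have := hcov x y hcxy
      omega
  rw [← hinj.ncard_image, himage, Set.ncard_eq_toFinset_card']
  simp

theorem IsChainClosed.isGradedPoset {C : Set (Equiv.Perm (Fin n))} (hC : IsChainClosed C)
    (hone : 1 ∈ C) {t : Equiv.Perm (Fin n)} (ht : IsGreatest C t) : IsGradedPoset C := by
  have key : ∀ s : Set C, IsMaxChain (· ≤ ·) s → s.ncard = inversionNumber t + 1 := by
    intro s hs
    refine ncard_of_isMaxChain (fun z : C => inversionNumber (z : Equiv.Perm (Fin n)))
      (fun u v h => inversionNumber_strictMono h)
      (fun u v h => inversionNumber_of_covBy (hC.covBy u v h))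
      (b := ⟨1, hone⟩) (t := ⟨t, ht.1⟩) (fun z => one_le_perm z.1) ?_ (fun z => ht.2 z.2) hs
    rw [inversionNumber, Finset.card_eq_zero, Finset.filter_eq_empty_iff]
    intro p _ hp
    exact hp.1.not_gt hp.2
  intro s s' hs hs'
  rw [key s hs, key s' hs']

theorem IsChainClosed.isELShellable {C : Set (Equiv.Perm (Fin n))} (hC : IsChainClosed C)
    (hone : 1 ∈ C) {t : Equiv.Perm (Fin n)} (ht : IsGreatest C t) : IsELShellable C :=
  ⟨inferInstance, hC.isGradedPoset hone ht, ⟨⟨1, hone⟩, fun z => one_le_perm z.1⟩,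
    ⟨⟨t, ht.1⟩, fun z => ht.2 z.2⟩, _, inferInstance, _, hC.isELLabeling⟩

end InducedOrder

/-! ### Standard forms are the standard cyclic forms of their products -/

section StandardForm

variable {n : ℕ}

/-- A list of words is a standard form if each word starts with its smallest letter and the first
letters increase. -/
def IsStandardForm (L : List (List (Fin n))) : Prop :=
  (∀ l ∈ L, ∃ a, l.head? = some a ∧ ∀ b ∈ l, a ≤ b) ∧
    L.Pairwise fun l l' => ∀ a, l.head? = some a → ∀ b, l'.head? = some b → a < b

theorem prod_formPerm_apply_of_notMem {L : List (List (Fin n))} {a : Fin n}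
    (h : ∀ l ∈ L, a ∉ l) : (L.map List.formPerm).prod a = a := by
  induction L with
  | nil => rfl
  | cons l L ih =>
    rw [List.map_cons, List.prod_cons, Equiv.Perm.mul_apply,
      ih fun l' hl' => h l' (List.mem_cons_of_mem _ hl'),
      List.formPerm_apply_of_notMem (h l List.mem_cons_self)]

/-- A product of cycles with disjoint supports acts on the entries of each cycle as this cycle. -/
theorem prod_formPerm_apply {L : List (List (Fin n))} (hL : L.flatten.Nodup) {l : List (Fin n)}
    (hl : l ∈ L) {a : Fin n} (ha : a ∈ l) : (L.map List.formPerm).prod a = l.formPerm a := by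
  induction L with
  | nil => simp at hl
  | cons l' L ih =>
    rw [List.flatten_cons, List.nodup_append'] at hL
    obtain ⟨-, h2, h3⟩ := hL
    rw [List.map_cons, List.prod_cons, Equiv.Perm.mul_apply]
    rcases List.mem_cons.1 hl with rfl | hl
    · rw [prod_formPerm_apply_of_notMem]
      exact fun m hm ham => h3 ha (List.mem_flatten.2 ⟨m, hm, ham⟩)
    · rw [ih h2 hl]
      refine List.formPerm_apply_of_notMem fun hmem => h3 hmem (List.mem_flatten.2 ⟨l, hl, ?_⟩)
      exact List.formPerm_apply_mem_of_mem ha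

/-- The letters of the list are stable under its cycle, so the powers of `x` and of the cycle agree
at `a`. The one-letter list is separate because `toList` is empty at a fixed point. -/
theorem cycleList_of_forall_apply_eq {x : Equiv.Perm (Fin n)} {a : Fin n} {t : List (Fin n)}
    (hnd : (a :: t).Nodup) (hx : ∀ b ∈ a :: t, x b = (a :: t).formPerm b) :
    cycleList x a = a :: t := by
  have hmemz : ∀ k : ℕ, ((a :: t).formPerm ^ k) a ∈ a :: t := by
    intro k
    induction k with
    | zero => simp
    | succ k ih =>
      rw [pow_succ', Equiv.Perm.mul_apply]
      exact List.formPerm_apply_mem_of_mem ih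
  have hpow : ∀ k : ℕ, (x ^ k) a = ((a :: t).formPerm ^ k) a := by
    intro k
    induction k with
    | zero => rfl
    | succ k ih =>
      rw [pow_succ', pow_succ', Equiv.Perm.mul_apply, Equiv.Perm.mul_apply, ih, hx _ (hmemz k)]
  have hsame : ∀ b, x.SameCycle a b ↔ (a :: t).formPerm.SameCycle a b := by
    intro b
    constructor
    · intro h
      obtain ⟨k, -, hk⟩ := h.exists_pow_eq'
      exact ⟨k, by rw [zpow_natCast, ← hpow, hk]⟩
    · intro h
      obtain ⟨k, -, hk⟩ := h.exists_pow_eq'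
      exact ⟨k, by rw [zpow_natCast, hpow, hk]⟩
  have hcyc : x.cycleOf a = (a :: t).formPerm.cycleOf a := by
    ext1 b
    rw [Equiv.Perm.cycleOf_apply, Equiv.Perm.cycleOf_apply]
    by_cases h : x.SameCycle a b
    · rw [if_pos h, if_pos ((hsame b).1 h)]
      obtain ⟨k, -, rfl⟩ := h.exists_pow_eq'
      rw [hpow]
      exact hx _ (hmemz k)
    · rw [if_neg h, if_neg fun h' => h ((hsame b).2 h')]
  unfold cycleList
  cases t with
  | nil =>
    have : x a = a := by
      rw [hx a List.mem_cons_self, List.formPerm_singleton]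
      rfl
    rw [if_pos this]
  | cons b t =>
    have hxa : x a ≠ a := by
      rw [hx a List.mem_cons_self, List.formPerm_apply_head _ _ _ hnd]
      rintro rfl
      simp at hnd
    rw [if_neg hxa]
    have h2 := Equiv.Perm.toList_formPerm_nontrivial (a :: b :: t) (by simp) hnd
    refine Eq.trans ?_ h2
    change x.toList a = (a :: b :: t).formPerm.toList a
    refine List.ext_getElem (by rw [Equiv.Perm.length_toList, Equiv.Perm.length_toList, hcyc])
      fun k hk hk' => ?_
    rw [Equiv.Perm.getElem_toList, Equiv.Perm.getElem_toList, hpow]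

theorem head?_cycleList (x : Equiv.Perm (Fin n)) (a : Fin n) :
    (cycleList x a).head? = some a := by
  unfold cycleList
  split_ifs with h
  · rfl
  · have h' : a ∈ x.support := Equiv.Perm.mem_support.2 h
    rw [List.head?_eq_getElem?,
      List.getElem?_eq_getElem (Equiv.Perm.length_toList_pos_of_mem_support _ _ h'),
      Equiv.Perm.toList_getElem_zero _ _ h']

theorem pairwise_cycleMins (x : Equiv.Perm (Fin n)) : (cycleMins x).Pairwise (· < ·) :=
  (List.pairwise_lt_finRange n).filter _

theorem isStandardForm_standardCyclicForm (x : Equiv.Perm (Fin n)) :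
    IsStandardForm (standardCyclicForm x) := by
  refine ⟨fun l hl => ?_, ?_⟩
  · obtain ⟨a, ha, rfl⟩ := List.mem_map.1 hl
    exact ⟨a, head?_cycleList x a,
      fun b hb => (mem_cycleMins x a).1 ha b ((mem_cycleList x a b).1 hb)⟩
  · rw [standardCyclicForm, List.pairwise_map]
    refine (pairwise_cycleMins x).imp fun {a b} hab c hc d hd => ?_
    rw [head?_cycleList, Option.some.injEq] at hc hd
    rwa [← hc, ← hd]

/-- A standard form is the standard cyclic form of the product of its cycles. -/
theorem standardCyclicForm_prod_formPerm {L : List (List (Fin n))} (hnd : L.flatten.Nodup)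
    (hmem : ∀ a, a ∈ L.flatten) (hL : IsStandardForm L) :
    standardCyclicForm (L.map List.formPerm).prod = L := by
  set x := (L.map List.formPerm).prod with hx
  have hcyc : ∀ l ∈ L, ∀ a, l.head? = some a → cycleList x a = l := by
    intro l hl a ha
    obtain ⟨t, rfl⟩ := List.head?_eq_some_iff.1 ha
    refine cycleList_of_forall_apply_eq ((List.nodup_flatten.1 hnd).1 _ hl) fun b hb => ?_
    exact prod_formPerm_apply hnd hl hb
  have hmins : cycleMins x = L.filterMap List.head? := by
    refine List.Pairwise.eq_of_mem_iff (pairwise_cycleMins x) ?_ fun a => ?_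
    · rw [List.pairwise_filterMap]
      exact hL.2
    · rw [mem_cycleMins, List.mem_filterMap]
      constructor
      · intro ha
        obtain ⟨l, hl, hal⟩ := List.mem_flatten.1 (hmem a)
        obtain ⟨b, hb, hmin⟩ := hL.1 l hl
        refine ⟨l, hl, ?_⟩
        have hs : x.SameCycle b a := by
          rw [← mem_cycleList, hcyc l hl b hb]
          exact hal
        rw [le_antisymm (ha b hs.symm) (hmin a hal), hb]
      · rintro ⟨l, hl, ha⟩ b hb
        rw [← mem_cycleList, hcyc l hl a ha] at hb
        obtain ⟨a', ha', hmin⟩ := hL.1 l hl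
        rw [ha, Option.some.injEq] at ha'
        rw [ha']
        exact hmin b hb
  rw [standardCyclicForm, hmins, List.map_filterMap]
  have : ∀ l ∈ L, (l.head?.map (cycleList x)) = some l := by
    intro l hl
    obtain ⟨a, ha, -⟩ := hL.1 l hl
    rw [ha, Option.map_some, hcyc l hl a ha]
  rw [List.filterMap_congr this]
  exact List.filterMap_some

end StandardForm

/-! ### Description of `C_λ` by block minima -/

section Blocks

variable {n : ℕ}

/-- The one-line notation of a permutation, cut into blocks along a composition. -/
def blockWords (lam : Composition n) (w : Equiv.Perm (Fin n)) : List (List (Fin n)) :=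
  List.ofFn fun i : Fin lam.length => List.ofFn fun t => w (lam.embedding i t)

theorem map_length_blockWords (lam : Composition n) (w : Equiv.Perm (Fin n)) :
    (blockWords lam w).map List.length = lam.blocks := by
  rw [← lam.ofFn_blocksFun, blockWords, List.map_ofFn]
  congr 1
  funext i
  simp

theorem blockWords_eq_split (lam : Composition n) (w : Equiv.Perm (Fin n)) :
    blockWords lam w = (List.ofFn w).splitWrtComposition lam := by
  refine List.ext_getElem (by simp [blockWords, List.length_splitWrtComposition])
    fun i hi hi' => ?_
  have hi2 : i < lam.length := by simpa [blockWords] using hi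
  have hle := lam.sizeUpTo_le (i + 1)
  have hsucc := lam.sizeUpTo_succ' ⟨i, hi2⟩
  simp only at hsucc
  rw [List.getElem_splitWrtComposition]
  simp only [blockWords, List.getElem_ofFn]
  refine List.ext_getElem ?_ fun t ht ht' => ?_
  · simp only [List.length_ofFn, List.length_drop, List.length_take]
    omega
  · simp only [List.getElem_ofFn, List.getElem_drop, List.getElem_take]
    rfl

theorem flatten_blockWords (lam : Composition n) (w : Equiv.Perm (Fin n)) :
    (blockWords lam w).flatten = List.ofFn w := by
  rw [blockWords_eq_split]
  exact List.flatten_splitWrtCompositionAux (by rw [lam.blocks_sum, List.length_ofFn])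

theorem ofFn_Omega (x : Equiv.Perm (Fin n)) : List.ofFn (Omega x) = omegaWord x := by
  refine List.ext_getElem (by rw [List.length_ofFn, length_omegaWord]) fun k hk hk' => ?_
  rw [List.getElem_ofFn, Omega_apply]

theorem blockWords_Omega {lam : Composition n} {x : Equiv.Perm (Fin n)}
    (hx : x ∈ compositionClass lam) : blockWords lam (Omega x) = standardCyclicForm x := by
  -- A list of words is determined by its concatenation and the lengths of the words.
  rw [List.eq_iff_flatten_eq, flatten_blockWords, ofFn_Omega, map_length_blockWords]
  exact ⟨rfl, Eq.symm hx⟩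

/-- The position `p` is the first one of its block. -/
def IsBlockStart (lam : Composition n) (p : Fin n) : Prop :=
  lam.sizeUpTo (lam.index p) = p

/-- The entries at the first positions of the blocks are smaller than all later entries. -/
def HasBlockMinima (lam : Composition n) (w : Equiv.Perm (Fin n)) : Prop :=
  ∀ p q : Fin n, IsBlockStart lam p → p ≤ q → w p ≤ w q

theorem index_mono (lam : Composition n) {p q : Fin n} (h : p ≤ q) : lam.index p ≤ lam.index q := by
  by_contra hlt
  rw [not_le] at hlt
  have h1 := lam.lt_sizeUpTo_index_succ q
  have h2 := lam.sizeUpTo_index_le p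
  have h3 : lam.sizeUpTo (lam.index q).succ ≤ lam.sizeUpTo (lam.index p) :=
    lam.monotone_sizeUpTo hlt
  have h4 : (p : ℕ) ≤ q := h
  omega

/-- The first position of a block. -/
def blockStart (lam : Composition n) (i : Fin lam.length) : Fin n :=
  lam.embedding i ⟨0, lam.one_le_blocksFun i⟩

theorem index_blockStart (lam : Composition n) (i : Fin lam.length) :
    lam.index (blockStart lam i) = i :=
  lam.index_embedding i _

theorem coe_blockStart (lam : Composition n) (i : Fin lam.length) :
    (blockStart lam i : ℕ) = lam.sizeUpTo i :=
  lam.coe_embedding i _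

theorem isBlockStart_blockStart (lam : Composition n) (i : Fin lam.length) :
    IsBlockStart lam (blockStart lam i) := by
  rw [IsBlockStart, index_blockStart, coe_blockStart]

theorem IsBlockStart.eq_blockStart {lam : Composition n} {p : Fin n} (h : IsBlockStart lam p) :
    p = blockStart lam (lam.index p) :=
  Fin.ext (by rw [coe_blockStart]; exact h.symm)

theorem head?_block (lam : Composition n) (w : Equiv.Perm (Fin n)) (i : Fin lam.length) :
    (List.ofFn fun t => w (lam.embedding i t)).head? = some (w (blockStart lam i)) := by
  have h : 0 < lam.blocksFun i := lam.one_le_blocksFun i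
  rw [List.head?_eq_getElem?, List.getElem?_ofFn, dif_pos h]
  rfl

theorem isStandardForm_blockWords_iff (lam : Composition n) (w : Equiv.Perm (Fin n)) :
    IsStandardForm (blockWords lam w) ↔ HasBlockMinima lam w := by
  constructor
  · rintro ⟨h1, h2⟩ p q hp hpq
    rw [blockWords, List.pairwise_ofFn] at h2
    -- The comparison of `p` with `q` passes through the first entry of the block of `q`.
    have hq : w (blockStart lam (lam.index q)) ≤ w q := by
      obtain ⟨a, ha, hmin⟩ := h1 _ (List.mem_ofFn.2 ⟨lam.index q, rfl⟩)
      rw [head?_block, Option.some.injEq] at ha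
      rw [ha]
      refine hmin _ (List.mem_ofFn.2 ⟨lam.invEmbedding q, ?_⟩)
      rw [lam.embedding_comp_inv]
    refine le_trans ?_ hq
    rw [hp.eq_blockStart]
    rcases (index_mono lam hpq).lt_or_eq with h | h
    · exact (h2 h _ (head?_block ..) _ (head?_block ..)).le
    · rw [h]
  · intro h
    refine ⟨fun l hl => ?_, ?_⟩
    · obtain ⟨i, rfl⟩ := List.mem_ofFn.1 hl
      refine ⟨_, head?_block .., fun b hb => ?_⟩
      obtain ⟨t, rfl⟩ := List.mem_ofFn.1 hb
      exact h _ _ (isBlockStart_blockStart lam i)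
        ((lam.embedding i).monotone (Fin.le_def.2 (Nat.zero_le _)))
    · rw [blockWords, List.pairwise_ofFn]
      intro i j hij a ha b hb
      rw [head?_block, Option.some.injEq] at ha hb
      rw [← ha, ← hb]
      have hlt : blockStart lam i < blockStart lam j := by
        rw [Fin.lt_def, coe_blockStart, coe_blockStart]
        exact (lam.sizeUpTo_strict_mono i.2).trans_le (lam.monotone_sizeUpTo hij)
      exact lt_of_le_of_ne (h _ _ (isBlockStart_blockStart lam i) hlt.le)
        fun e => hlt.ne (w.injective e)

theorem standardCyclicForm_of_hasBlockMinima {lam : Composition n} {w : Equiv.Perm (Fin n)}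
    (h : HasBlockMinima lam w) :
    standardCyclicForm ((blockWords lam w).map List.formPerm).prod = blockWords lam w := by
  refine standardCyclicForm_prod_formPerm ?_ ?_ ((isStandardForm_blockWords_iff lam w).2 h)
  · rw [flatten_blockWords, List.nodup_ofFn]
    exact w.injective
  · intro a
    rw [flatten_blockWords, List.mem_ofFn]
    exact w.surjective a

theorem mem_compositionClass_of_hasBlockMinima {lam : Composition n} {w : Equiv.Perm (Fin n)}
    (h : HasBlockMinima lam w) :
    ((blockWords lam w).map List.formPerm).prod ∈ compositionClass lam := by
  change List.map List.length _ = _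
  rw [standardCyclicForm_of_hasBlockMinima h, map_length_blockWords]

theorem Omega_of_hasBlockMinima {lam : Composition n} {w : Equiv.Perm (Fin n)}
    (h : HasBlockMinima lam w) : Omega ((blockWords lam w).map List.formPerm).prod = w := by
  have h1 : List.ofFn (Omega ((blockWords lam w).map List.formPerm).prod) = List.ofFn w := by
    rw [ofFn_Omega, omegaWord, standardCyclicForm_of_hasBlockMinima h, flatten_blockWords]
  exact Equiv.ext fun k => congrFun (List.ofFn_injective h1) k

/-- This trades cycle structure for inequalities between entries. The preimage of `w` is the product
of the cycles read off its blocks. -/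
theorem mem_omegaClass_iff {lam : Composition n} {w : Equiv.Perm (Fin n)} :
    w ∈ omegaClass lam ↔ HasBlockMinima lam w := by
  constructor
  · rintro ⟨x, hx, rfl⟩
    rw [← isStandardForm_blockWords_iff, blockWords_Omega hx]
    exact isStandardForm_standardCyclicForm x
  · intro h
    exact ⟨_, mem_compositionClass_of_hasBlockMinima h, Omega_of_hasBlockMinima h⟩

theorem hasBlockMinima_one (lam : Composition n) : HasBlockMinima lam 1 :=
  fun _ _ _ h => h

theorem HasBlockMinima.lt {lam : Composition n} {w : Equiv.Perm (Fin n)}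
    (h : HasBlockMinima lam w) {p q : Fin n} (hp : IsBlockStart lam p) (hpq : p < q) : w p < w q :=
  lt_of_le_of_ne (h p q hp hpq.le) fun e => hpq.ne (w.injective e)

/-- Greedy exchanges towards a permutation with block minima preserve block minima. -/
theorem HasBlockMinima.mul_swap {lam : Composition n} {x y : Equiv.Perm (Fin n)}
    (hx : HasBlockMinima lam x) (hy : HasBlockMinima lam y) {i j : Fin n}
    (hg : IsGreedyExchange x y i j) : HasBlockMinima lam (x * Equiv.swap i j) := by
  -- In `y` the value `x i` occurs after position `i` but is smaller than `y i`, so `i` cannot open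
  -- a block.
  have hi : ¬ IsBlockStart lam i := by
    intro hi
    have h1 : x i < y i := hg.lt.trans_le hg.le
    have h2 : i < y.symm (x i) := by
      refine lt_of_le_of_ne (le_of_not_gt fun hlt => ?_) fun e => ?_
      · have := hg.agree _ hlt
        rw [Equiv.apply_symm_apply] at this
        exact hlt.ne (x.injective this)
      · have : y i = x i := by
          conv_lhs => rw [e]
          rw [Equiv.apply_symm_apply]
        exact h1.ne' this
    have h3 := hy.lt hi h2
    rw [Equiv.apply_symm_apply] at h3
    exact h1.not_gt h3
  intro p q hp hpq
  rcases hpq.eq_or_lt with rfl | hpq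
  · exact le_rfl
  refine le_of_lt ?_
  rw [Equiv.Perm.mul_apply, Equiv.Perm.mul_apply]
  have hpi : p ≠ i := by
    rintro rfl
    exact hi hp
  have hij := hg.pos_lt
  by_cases hpj : p = j
  · subst hpj
    rw [Equiv.swap_apply_right, Equiv.swap_apply_of_ne_of_ne (hij.trans hpq).ne' hpq.ne']
    exact hg.lt.trans (hx.lt hp hpq)
  · rw [Equiv.swap_apply_of_ne_of_ne hpi hpj]
    by_cases hqi : q = i
    · subst hqi
      rw [Equiv.swap_apply_left]
      exact hx.lt hp (hpq.trans hij)
    by_cases hqj : q = j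
    · subst hqj
      rw [Equiv.swap_apply_right]
      rcases lt_or_gt_of_ne hpi with h | h
      · exact hx.lt hp h
      -- Here `p` lies between `i` and `j` and `x p < x j`, so the gap condition forces `x p` below
      -- `x i`, the new entry at `j`.
      · have h1 := hg.no_between p h hpq
        have h2 := hx.lt hp hpq
        refine lt_of_le_of_ne (le_of_not_gt fun h3 => h1 ⟨h3, h2⟩) fun e => hpi (x.injective e)
    · rw [Equiv.swap_apply_of_ne_of_ne hqi hqj]
      exact hx.lt hp hpq

theorem isChainClosed_omegaClass (lam : Composition n) : IsChainClosed (omegaClass lam) := by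
  intro x hx y hy hxy
  refine exists_isRisingChain hxy.le hx fun z hz i j hg => ?_
  rw [mem_omegaClass_iff] at hz hy ⊢
  exact hz.mul_swap hy hg

end Blocks

/-! ### The greatest element -/

section Maximum

variable {n : ℕ}

/-- Blocks are nonempty, so `sizeUpTo k - k` is weakly increasing; the additive form avoids
truncated subtraction. -/
theorem sizeUpTo_add_le (lam : Composition n) {i j : ℕ} (hij : i ≤ j) (hj : j ≤ lam.length) :
    lam.sizeUpTo i + j ≤ lam.sizeUpTo j + i := by
  induction j, hij using Nat.le_induction with
  | base => exact le_rfl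
  | succ j _ ih =>
    have h1 := ih (by omega)
    have h2 := lam.sizeUpTo_strict_mono (i := j) hj
    omega

theorem excessUpTo_add (lam : Composition n) (i : Fin lam.length) :
    excessUpTo lam i + i = lam.sizeUpTo i := by
  have key : ∀ k ≤ lam.length,
      (∑ j : Fin lam.length, if (j : ℕ) < k then lam.blocksFun j - 1 else 0) + k =
        lam.sizeUpTo k := by
    intro k
    induction k with
    | zero => simp
    | succ k ih =>
      intro hk
      have h1 := ih (by omega)
      have h2 := lam.sizeUpTo_succ' ⟨k, hk⟩
      have h3 := lam.one_le_blocksFun ⟨k, hk⟩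
      have h4 : (∑ j : Fin lam.length, if (j : ℕ) < k + 1 then lam.blocksFun j - 1 else 0) =
          (∑ j : Fin lam.length, if (j : ℕ) < k then lam.blocksFun j - 1 else 0) +
            (lam.blocksFun ⟨k, hk⟩ - 1) := by
        have h5 : lam.blocksFun ⟨k, hk⟩ - 1 =
            ∑ j : Fin lam.length, if j = ⟨k, hk⟩ then lam.blocksFun j - 1 else 0 := by
          rw [Finset.sum_ite_eq' Finset.univ, if_pos (Finset.mem_univ _)]
        rw [h5, ← Finset.sum_add_distrib]
        refine Finset.sum_congr rfl fun j _ => ?_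
        have h6 : j = ⟨k, hk⟩ ↔ (j : ℕ) = k := Fin.ext_iff
        simp only [h6]
        split_ifs <;> omega
      simp only at h2
      omega
  exact key i i.2.le

theorem index_lt_of_not_isBlockStart {lam : Composition n} {q : Fin n}
    (hq : ¬ IsBlockStart lam q) : (lam.index q : ℕ) < q := by
  have h1 := lam.sizeUpTo_index_le q
  have h2 := sizeUpTo_add_le lam (Nat.zero_le _) (lam.index q).2.le
  have h3 : lam.sizeUpTo (lam.index q) ≠ q := hq
  omega

open Classical in
/-- The entries of the greatest element: the first positions of the blocks carry the smallest
entries in increasing order, the other positions carry the other entries in decreasing order. -/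
noncomputable def maxEntry (lam : Composition n) (q : Fin n) : Fin n :=
  if h : IsBlockStart lam q then Fin.castLE lam.length_le (lam.index q)
  else ⟨n + lam.index q - q, by
    have := index_lt_of_not_isBlockStart h
    omega⟩

theorem coe_maxEntry_of_isBlockStart {lam : Composition n} {q : Fin n} (h : IsBlockStart lam q) :
    (maxEntry lam q : ℕ) = lam.index q := by
  rw [maxEntry, dif_pos h]
  rfl

theorem coe_maxEntry_of_not_isBlockStart {lam : Composition n} {q : Fin n}
    (h : ¬ IsBlockStart lam q) : (maxEntry lam q : ℕ) = n + lam.index q - q := by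
  rw [maxEntry, dif_neg h]

theorem maxEntry_lt_of_lt {lam : Composition n} {p q : Fin n} (hp : ¬ IsBlockStart lam p)
    (hq : ¬ IsBlockStart lam q) (hpq : p < q) : maxEntry lam q < maxEntry lam p := by
  rw [Fin.lt_def, coe_maxEntry_of_not_isBlockStart hp, coe_maxEntry_of_not_isBlockStart hq]
  have h1 : lam.index p ≤ lam.index q := index_mono lam hpq.le
  have h2 : (p : ℕ) < q := hpq
  rcases h1.eq_or_lt with h | h
  · rw [h]
    omega
  · have h3 := lam.lt_sizeUpTo_index_succ p
    have h4 := lam.sizeUpTo_index_le q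
    have h5 : lam.sizeUpTo (lam.index q) ≠ q := hq
    have h6 : (lam.index p : ℕ) < lam.index q := h
    have h7 := sizeUpTo_add_le lam (i := (lam.index p).succ) (j := lam.index q)
      h (lam.index q).2.le
    simp only [Fin.val_succ] at h3 h7
    omega

theorem maxEntry_lt_of_isBlockStart {lam : Composition n} {p q : Fin n} (hp : IsBlockStart lam p)
    (hq : ¬ IsBlockStart lam q) : maxEntry lam p < maxEntry lam q := by
  rw [Fin.lt_def, coe_maxEntry_of_isBlockStart hp, coe_maxEntry_of_not_isBlockStart hq]
  have h1 := (lam.index p).2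
  have h2 := lam.lt_sizeUpTo_index_succ q
  have h3 := sizeUpTo_add_le lam (i := (lam.index q).succ) (j := lam.length)
    (lam.index q).2 le_rfl
  rw [lam.sizeUpTo_length] at h3
  simp only [Fin.val_succ] at h2 h3
  omega

theorem maxEntry_injective (lam : Composition n) : Function.Injective (maxEntry lam) := by
  intro p q h
  by_cases hp : IsBlockStart lam p <;> by_cases hq : IsBlockStart lam q
  · have h1 := congrArg Fin.val h
    rw [coe_maxEntry_of_isBlockStart hp, coe_maxEntry_of_isBlockStart hq] at h1
    rw [hp.eq_blockStart, hq.eq_blockStart, Fin.ext h1]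
  · exact absurd h (maxEntry_lt_of_isBlockStart hp hq).ne
  · exact absurd h (maxEntry_lt_of_isBlockStart hq hp).ne'
  · rcases lt_trichotomy p q with hpq | hpq | hpq
    · exact absurd h (maxEntry_lt_of_lt hp hq hpq).ne'
    · exact hpq
    · exact absurd h (maxEntry_lt_of_lt hq hp hpq).ne

/-- The greatest element of `omegaClass lam`. -/
noncomputable def maxWord (lam : Composition n) : Equiv.Perm (Fin n) :=
  Equiv.ofBijective (maxEntry lam) (Finite.injective_iff_bijective.1 (maxEntry_injective lam))

theorem maxWord_apply (lam : Composition n) (q : Fin n) : maxWord lam q = maxEntry lam q := rfl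

theorem hasBlockMinima_maxWord (lam : Composition n) : HasBlockMinima lam (maxWord lam) := by
  intro p q hp hpq
  rw [maxWord_apply, maxWord_apply]
  by_cases hq : IsBlockStart lam q
  · rw [Fin.le_def, coe_maxEntry_of_isBlockStart hp, coe_maxEntry_of_isBlockStart hq]
    exact index_mono lam hpq
  · exact (maxEntry_lt_of_isBlockStart hp hq).le

/-- At offset `t + 1` of block `i` the entry `n + i - (sizeUpTo i + t + 1)` equals `n - 1 -
excessUpTo i - t` by `excessUpTo_add`. -/
theorem blockWords_maxWord (lam : Composition n) :
    blockWords lam (maxWord lam) = List.ofFn (maxCycle lam) := by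
  rw [blockWords]
  congr 1
  funext i
  have hpos := lam.one_le_blocksFun i
  refine List.ext_getElem (by simp [maxCycle, hpos]) fun t ht ht' => ?_
  simp only [List.length_ofFn] at ht
  rw [List.getElem_ofFn, maxWord_apply, Fin.ext_iff]
  have hidx : lam.index (lam.embedding i ⟨t, ht⟩) = i := lam.index_embedding i _
  have hval : (lam.embedding i ⟨t, ht⟩ : ℕ) = lam.sizeUpTo i + t := lam.coe_embedding i _
  cases t with
  | zero =>
    have hs : IsBlockStart lam (lam.embedding i ⟨0, ht⟩) := isBlockStart_blockStart lam i
    rw [coe_maxEntry_of_isBlockStart hs, hidx]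
    rfl
  | succ t =>
    have hns : ¬ IsBlockStart lam (lam.embedding i ⟨t + 1, ht⟩) := by
      rw [IsBlockStart, hidx, hval]
      omega
    rw [coe_maxEntry_of_not_isBlockStart hns, hidx, hval]
    have := excessUpTo_add lam i
    simp only [maxCycle, List.getElem_cons_succ, List.getElem_ofFn]
    omega

theorem prod_blockWords_maxWord (lam : Composition n) :
    ((blockWords lam (maxWord lam)).map List.formPerm).prod = maxPerm lam := by
  rw [blockWords_maxWord, maxPerm, List.map_ofFn]
  rfl

theorem le_maxWord {lam : Composition n} {w : Equiv.Perm (Fin n)} (h : HasBlockMinima lam w) :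
    w ≤ maxWord lam := by
  refine le_of_entryCount_le fun a b => ?_
  set m := maxWord lam with hm
  -- If a position before `a` that opens no block already carries an entry of `m` below `b`, so do
  -- all positions from `a` on. Then all values at least `b` occur in `m` before `a`, and the count
  -- of `m` is as large as possible.
  by_cases hcase : ∃ c : Fin n, ¬ IsBlockStart lam c ∧ (c : ℕ) < a ∧ (m c : ℕ) < b
  · obtain ⟨c, hc, hca, hcb⟩ := hcase
    refine Finset.card_le_card_of_injOn (fun d => m.symm (w d)) ?_
      (m.symm.injective.comp w.injective).injOn
    intro d hd
    have hdb : b ≤ (w d : ℕ) := (Finset.mem_filter.1 hd).2.2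
    refine Finset.mem_coe.2 (Finset.mem_filter.2 ⟨Finset.mem_univ _, ?_, by simpa using hdb⟩)
    change (m.symm (w d) : ℕ) < a
    generalize hu : m.symm (w d) = u
    have hu' : w d = m u := by rw [← hu, Equiv.apply_symm_apply]
    rw [hu'] at hdb
    by_contra hua
    have hcu : m c < m u := Fin.lt_def.2 (by omega)
    by_cases hs : IsBlockStart lam u
    · exact hcu.not_gt (maxEntry_lt_of_isBlockStart hs hc)
    · exact hcu.not_gt (maxEntry_lt_of_lt hc hs (Fin.lt_def.2 (by omega)))
  · have h1 := card_lt_add_entryCount w a b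
    have h2 := card_lt_add_entryCount m a b
    suffices hsuff : (Finset.univ.filter fun c : Fin n => (c : ℕ) < a ∧ (m c : ℕ) < b).card ≤
        (Finset.univ.filter fun c : Fin n => (c : ℕ) < a ∧ (w c : ℕ) < b).card by omega
    -- Now the small entries of `m` before `a` all open blocks. If `w` has a large entry at some
    -- block start before `a`, every later entry is large and all small values of `w` occur before
    -- `a`; otherwise `w` is small wherever `m` is.
    by_cases hp : ∃ p : Fin n, IsBlockStart lam p ∧ (p : ℕ) < a ∧ b ≤ (w p : ℕ)
    · obtain ⟨p, hp, hpa, hpb⟩ := hp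
      refine Finset.card_le_card_of_injOn (fun d => w.symm (m d)) ?_
        (w.symm.injective.comp m.injective).injOn
      intro d hd
      have hdb : (m d : ℕ) < b := (Finset.mem_filter.1 hd).2.2
      refine Finset.mem_coe.2 (Finset.mem_filter.2 ⟨Finset.mem_univ _, ?_, by simpa using hdb⟩)
      change (w.symm (m d) : ℕ) < a
      by_contra hua
      have h3 : w p ≤ w (w.symm (m d)) := h _ _ hp (Fin.le_def.2 (by omega))
      rw [Equiv.apply_symm_apply, Fin.le_def] at h3
      omega
    · refine Finset.card_le_card fun c hc => ?_
      obtain ⟨hca, hcb⟩ := (Finset.mem_filter.1 hc).2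
      refine Finset.mem_filter.2 ⟨Finset.mem_univ _, hca, ?_⟩
      have hcs : IsBlockStart lam c := by
        by_contra hcs
        exact hcase ⟨c, hcs, hca, hcb⟩
      by_contra hwb
      exact hp ⟨c, hcs, hca, not_lt.1 hwb⟩

theorem isGreatest_omegaClass (lam : Composition n) :
    IsGreatest (omegaClass lam) (Omega (maxPerm lam)) := by
  have h := hasBlockMinima_maxWord lam
  rw [← prod_blockWords_maxWord, Omega_of_hasBlockMinima h]
  exact ⟨mem_omegaClass_iff.2 h, fun w hw => le_maxWord (mem_omegaClass_iff.1 hw)⟩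

theorem isLeast_omegaClass (lam : Composition n) : IsLeast (omegaClass lam) 1 :=
  ⟨mem_omegaClass_iff.2 (hasBlockMinima_one lam), fun w _ => one_le_perm w⟩

end Maximum

theorem mainTheorem1 {n : ℕ} (lam : Composition n) :
    -- `C_λ` is bounded: minimum `id`, maximum `Ω(π_λ)`, where `π_λ` has composition type `λ`
    IsLeast (omegaClass lam) 1 ∧
    standardCyclicForm (maxPerm lam) = List.ofFn (maxCycle lam) ∧
    maxPerm lam ∈ compositionClass lam ∧
    IsGreatest (omegaClass lam) (Omega (maxPerm lam)) ∧
    -- `C_λ` with the restricted Bruhat–Chevalley order is graded and EL-shellable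
    IsGradedPoset (omegaClass lam) ∧
    IsELShellable (omegaClass lam) ∧
    -- the restriction of the labeling of `S_n` by right multiplication is an EL-labeling
    (∃ hC : ∀ x y : omegaClass lam, x ⋖ y →
        (x : Equiv.Perm (Fin n)) ⋖ (y : Equiv.Perm (Fin n)),
      IsELLabeling (restrictedLabel hC)) ∧
    -- the unique rising, lexicographically smallest chain of `S_n` between two elements of `C_λ`
    -- stays inside `C_λ`
    (∀ x ∈ omegaClass lam, ∀ y ∈ omegaClass lam, x < y →
      ∃ c : SaturatedChain (Equiv.Perm (Fin n)), IsRisingChain bruhatLabel x y c ∧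
        ∀ i, c i ∈ omegaClass lam) := by
  have h := hasBlockMinima_maxWord lam
  refine ⟨isLeast_omegaClass lam, ?_, ?_, isGreatest_omegaClass lam,
    (isChainClosed_omegaClass lam).isGradedPoset (isLeast_omegaClass lam).1
      (isGreatest_omegaClass lam),
    (isChainClosed_omegaClass lam).isELShellable (isLeast_omegaClass lam).1
      (isGreatest_omegaClass lam),
    ⟨(isChainClosed_omegaClass lam).covBy, (isChainClosed_omegaClass lam).isELLabeling⟩,
    isChainClosed_omegaClass lam⟩
  · rw [← prod_blockWords_maxWord, standardCyclicForm_of_hasBlockMinima h, blockWords_maxWord]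
  · rw [← prod_blockWords_maxWord]
    exact mem_compositionClass_of_hasBlockMinima h
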